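/- **Setting.** An environment is a family $\omega=(\omega_{xy})_{x,y\in\mathbb Z}$ of nonnegative numbers with $\sum_y\omega_{xy}=1$ for every $x\in\mathbb Z$. The space $\Omega$ of environments carries the product topology and its Borel $\sigma$-algebra, and $(\theta_z\omega)_{xy}=\omega_{x+z,y}$. For an integer $\varrho>1$ the truncated environment $\omega^\varrho$ is given by $\omega^\varrho_{xy}=\omega_{xy}$ if $0<|y|<\varrho$, $\omega^\varrho_{xy}=0$ if $|y|\ge\varrho$, and $\omega^\varrho_{x0}=\omega_{x0}+\sum_{|y|\ge\varrho}\omega_{xy}$; moreover $\omega^\infty=\omega$. Given $\omega$, let $S^\varrho=(S^\varrho_n)_{n\ge0}$ be the Markov chain on $\mathbb Z$ with $S^\varrho_0=0$ which jumps from $x$ to $x+y$ with probability $\omega^\varrho_{xy}$; its quenched law and expectation are $\mathtt P_\omega,\mathtt E_\omega$. The environment viewed from the particle is the Markov chain $\omega(n)=\theta_{S^\varrho_n}\omega$ on $\Omega$. Let $\mathbb P$ be a probability measure on $\Omega$ such that the sequence $(\omega_{x\,\cdot})_{x\in\mathbb Z}$ is stationary and ergodic under $\mathbb P$, and assume: *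 (E) there is $\tilde\varepsilon>0$ with $\omega_{01}\ge\tilde\varepsilon$ $\mathbb P$-a.s.; * (C) there are $\gamma_1>0$ and $\alpha>1$ such that for all real $s\ge1$, $\sum_{|y|\ge s}\omega_{0y}\le\gamma_1s^{-\alpha}$ $\mathbb P$-a.s.; * (D) there are an integer $\varrho_0>1$ and a non-increasing function $g_1\ge0$ on $\{0,1,2,\dots\}$ with $\sum_{k\ge1}k\,g_1(k)<\infty$ such that for all integers $x\le0$ and $\varrho\ge\varrho_0$, $\mathtt E_\omega\big[\#\{n\ge0:S^\varrho_n=x\}\big]\le g_1(|x|)$ $\mathbb P$-a.s. **Theorem.** For every $\varrho\in\{\varrho_0,\varrho_0+1,\dots\}\cup\{\infty\}$ there is a unique probability measure $\mathbb Q^\varrho\ll\mathbb P$ on $\Omega$ that is invariant for the environment viewed from the particle (with respect to $S^\varrho$), and $\mathbb Q^\varrho$ is ergodic for this Markov chain. There is a number $v_\varrho>0$, the speed, such that for $\mathbb P$-almost every $\omega$, $S^\varrho_n/n\to v_\varrho$ as $n\to\infty$, $\mathtt P_\omega$-a.s.; it is given by $$v_\varrho=\int_\Omega\mathtt E_\omega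 S^\varrho_1\,d\mathbb Q^\varrho,$$ where the expectation is finite for $\mathbb Q^\varrho$-almost every $\omega$ and $\mathbb Q^\varrho$-integrable in $\omega$. There are constants $0<\hat\gamma_1\le\hat\gamma_2<\infty$, not depending on $\varrho$, such that $\hat\gamma_1\le d\mathbb Q^\varrho/d\mathbb P\le\hat\gamma_2$ $\mathbb P$-a.s. for all $\varrho\in\{\varrho_0,\varrho_0+1,\dots\}\cup\{\infty\}$. Finally, as $\varrho\to\infty$, $\mathbb Q^\varrho\to\mathbb Q^\infty$ weakly and $v_\varrho\to v_\infty$. -/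

import Mathlib

open MeasureTheory ProbabilityTheory Filter Topology
open scoped NNReal ENNReal

namespace RWRE

/-- The space `Ω` of environments: nonnegative numbers `ω x y`, `x y ∈ ℤ`, with `∑ y, ω x y = 1`
for every `x`; `ω x y` is the probability of the jump `x → x + y`.  As a subtype of a countable
product it carries the product topology and its Borel σ-algebra. -/
abbrev Env : Type := {ω : ℤ → ℤ → ℝ≥0 // ∀ x, HasSum (ω x) 1}

/-- The spatial shift, `(θ_z ω)_{xy} = ω_{x+z,y}`. -/
def shift (z : ℤ) (ω : Env) : Env := ⟨fun x => ω.1 (x + z), fun x => ω.2 (x + z)⟩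

/-- The entries of the truncated environment: jumps of length `≥ ϱ` are rejected, and their mass is
put on the jump `0`.  The value `ϱ = ∞` gives the original environment. -/
noncomputable def truncFun (ϱ : ℕ∞) (ω : ℤ → ℤ → ℝ≥0) (x y : ℤ) : ℝ≥0 :=
  if y = 0 then ω x 0 + ∑' z : ℤ, (if z ≠ 0 ∧ ϱ ≤ (z.natAbs : ℕ∞) then ω x z else 0)
  else if (y.natAbs : ℕ∞) < ϱ then ω x y else 0

theorem truncFun_hasSum (ϱ : ℕ∞) (ω : Env) (x : ℤ) : HasSum (truncFun ϱ ω.1 x) 1 := by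
  have hs : Summable (ω.1 x) := (ω.2 x).summable
  set a : ℤ → ℝ≥0 := fun z => if z ≠ 0 ∧ ϱ ≤ (z.natAbs : ℕ∞) then ω.1 x z else 0 with ha
  set b : ℤ → ℝ≥0 := fun z => if z ≠ 0 ∧ ϱ ≤ (z.natAbs : ℕ∞) then 0 else ω.1 x z with hb
  have hab : ∀ z, a z + b z = ω.1 x z := by
    intro z
    by_cases h : z ≠ 0 ∧ ϱ ≤ (z.natAbs : ℕ∞) <;> simp [ha, hb, h]
  have hsa : Summable a := NNReal.summable_of_le (fun z => by rw [← hab z]; exact le_self_add) hs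
  have hsb : Summable b := NNReal.summable_of_le (fun z => by rw [← hab z]; exact le_add_self) hs
  have hsum : (∑' z, a z) + ∑' z, b z = 1 := by
    rw [← hsa.tsum_add hsb, ← (ω.2 x).tsum_eq]
    exact tsum_congr hab
  have h0 : HasSum (fun z : ℤ => if z = 0 then ∑' z, a z else 0) (∑' z, a z) :=
    hasSum_ite_eq 0 _
  have h := h0.add hsb.hasSum
  rw [hsum] at h
  convert h using 1
  funext y
  by_cases hy : y = 0
  · subst hy
    simp [truncFun, ha, hb, add_comm]
  · by_cases hlt : (y.natAbs : ℕ∞) < ϱ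
    · simp [truncFun, hb, hy, hlt, not_le.mpr hlt]
    · simp [truncFun, hb, hy, hlt, not_lt.mp hlt]

/-- The truncated environment `ω^ϱ`, for `ϱ ∈ {2, 3, …} ∪ {∞}`. -/
noncomputable def truncate (ϱ : ℕ∞) (ω : Env) : Env := ⟨truncFun ϱ ω.1, truncFun_hasSum ϱ ω⟩

/-- The distribution `ω_{x·}` of the jump from the site `x`. -/
noncomputable def jumpPMF (ω : Env) (x : ℤ) : PMF ℤ :=
  ⟨fun y => (ω.1 x y : ℝ≥0∞), by simpa using ENNReal.hasSum_coe.mpr (ω.2 x)⟩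

/-- The transition kernel of the random walk in the environment `ω`. -/
noncomputable def stepKernel (ω : Env) : Kernel ℤ ℤ :=
  Kernel.ofFunOfCountable fun x => ((jumpPMF ω x).map (fun y => x + y)).toMeasure

instance (ω : Env) : IsMarkovKernel (stepKernel ω) :=
  ⟨fun x => PMF.toMeasure.isProbabilityMeasure ((jumpPMF ω x).map (fun y => x + y))⟩

/-- The quenched law on trajectories of the walk in the environment `ω` started from `x₀`. -/
noncomputable def quenchedLaw (ω : Env) (x₀ : ℤ) : Measure (ℕ → ℤ) :=
  Kernel.traj (X := fun _ : ℕ => ℤ) (fun n => (stepKernel ω).comap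
    (fun h : (i : Finset.Iic n) → ℤ => h ⟨n, Finset.mem_Iic.mpr le_rfl⟩) (measurable_pi_apply _))
    0 (fun _ => x₀)

/-- The law of the truncated walk `S^ϱ` started from `0` in the environment `ω`. -/
noncomputable def walkLaw (ϱ : ℕ∞) (ω : Env) : Measure (ℕ → ℤ) := quenchedLaw (truncate ϱ ω) 0

/-- The total number `N_∞(x)` of visits of a trajectory to the site `x`. -/
noncomputable def visits (S : ℕ → ℤ) (x : ℤ) : ℝ≥0∞ := ∑' k : ℕ, if S k = x then 1 else 0

theorem measurable_coord (x y : ℤ) : Measurable fun ω : Env => ω.1 x y :=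
  (measurable_pi_apply y).comp ((measurable_pi_apply x).comp measurable_subtype_coe)

theorem measurable_shift (z : ℤ) : Measurable (shift z) :=
  Measurable.subtype_mk (measurable_pi_lambda _ fun x => measurable_pi_lambda _ fun y =>
    measurable_coord (x + z) y)

theorem measurable_truncate_coord (ϱ : ℕ∞) (x y : ℤ) :
    Measurable fun ω : Env => (truncate ϱ ω).1 x y := by
  change Measurable fun ω : Env => truncFun ϱ ω.1 x y
  unfold truncFun
  split_ifs
  · refine (measurable_coord x 0).add (Measurable.tsum fun z => ?_)
    split_ifs
    · exact measurable_coord x z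
    · exact measurable_const
  · exact measurable_coord x y
  · exact measurable_const

/-- The transition kernel of the environment viewed from the particle `ω(n) = θ_{S^ϱ_n} ω`:
from `ω` the process moves to `θ_y ω` with probability `ω^ϱ_{0y}`. -/
noncomputable def envKernel (ϱ : ℕ∞) : Kernel Env Env where
  toFun ω := (jumpPMF (truncate ϱ ω) 0).toMeasure.map fun y => shift y ω
  measurable' := by
    refine Measure.measurable_of_measurable_coe _ fun A hA => ?_
    have h : ∀ ω : Env, ((jumpPMF (truncate ϱ ω) 0).toMeasure.map fun y => shift y ω) A
        = ∑' y : ℤ, (shift y ⁻¹' A).indicator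
            (fun ω => ((truncate ϱ ω).1 0 y : ℝ≥0∞)) ω := by
      intro ω
      rw [Measure.map_apply (measurable_of_countable _) hA,
        PMF.toMeasure_apply _ (DiscreteMeasurableSpace.forall_measurableSet _)]
      rfl
    simp only [h]
    exact Measurable.tsum fun y =>
      (measurable_truncate_coord ϱ 0 y).coe_nnreal_ennreal.indicator (measurable_shift y hA)

/-- `μ` is an ergodic invariant measure of the Markov kernel `K`: it is invariant, and an event
that the chain started from `μ` a.s. neither enters nor leaves is `μ`-trivial. -/
def IsErgodicInvariant {α : Type*} [MeasurableSpace α] (K : Kernel α α) (μ : Measure α) : Prop :=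
  Kernel.Invariant K μ ∧ ∀ A : Set α, MeasurableSet A →
    (∀ᵐ a ∂μ, K a A = A.indicator 1 a) → μ A = 0 ∨ μ Aᶜ = 0

/-- Condition E: one-sided uniform ellipticity. -/
def ConditionE (P : Measure Env) : Prop :=
  ∃ ε : ℝ, 0 < ε ∧ ∀ᵐ ω ∂P, ε ≤ (ω.1 0 1 : ℝ)

/-- Condition C: uniform polynomial tails of the jumps, with exponent larger than one. -/
def ConditionC (P : Measure Env) : Prop :=
  ∃ γ α : ℝ, 0 < γ ∧ 1 < α ∧ ∀ s : ℝ, 1 ≤ s →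
    ∀ᵐ ω ∂P, ∑' y : ℤ, (if s ≤ |(y : ℝ)| then (ω.1 0 y : ℝ) else 0) ≤ γ * s ^ (-α)

/-- Condition D with threshold `ϱ₀`: uniform transience to the right. -/
def ConditionD (P : Measure Env) (ϱ₀ : ℕ) : Prop :=
  ∃ g : ℕ → ℝ, (∀ k, 0 ≤ g k) ∧ Antitone g ∧ Summable (fun k : ℕ => (k : ℝ) * g k) ∧
    ∀ x : ℤ, x ≤ 0 → ∀ ϱ : ℕ, ϱ₀ ≤ ϱ →
      ∀ᵐ ω ∂P, ∫⁻ S, visits S x ∂(walkLaw ϱ ω) ≤ ENNReal.ofReal (g x.natAbs)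

end RWRE

/-!
The invariant density is read off from the Green function. Let `u_k(ω)` be the expected number of
visits to `0` of the walk in `ω` started from `-k`. Decomposing a visit to `0` at its last step
shows that `(u_1 + ⋯ + u_n) / n` is an invariant density of the environment viewed from the
particle, up to a boundary term of `L¹`-norm `O(1/n)`, since jumps have a uniformly bounded first
moment (`lintegral_envKernel_mul_greenSum_le`). The `u_k` are bounded above by the maximum principle
(`green_le_diag`) and condition D. They are bounded below because a walk started far to the left
of `0` has to cross `[-M, 0]` and, by the tail bound and `∑ s ^ (-α) < ∞`, jumps over this
interval with probability at most `1/2` for `M` large; ellipticity then leads it to `0`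
(`le_mul_green`). Both bounds are uniform in the truncation level. Measures dominated by a multiple
of `P` are compact for setwise convergence (`exists_tendsto_measure_of_le`), so that a limit point
exists, is invariant, and has a density bounded away from `0` and `∞` (`exists_invariant`).

By ellipticity an event that is invariant for the environment chain is invariant under the spatial
shift, so every invariant measure equivalent to `P` is ergodic, and it is then the only invariant
probability measure absolutely continuous with respect to `P`
(`IsErgodicInvariant.eq_of_absolutelyContinuous`). The same
compactness gives an invariant measure without truncation as a limit point of those with
truncation, and uniqueness turns subsequential into full convergence
(`invariant_top_of_tendsto`, `tendsto_measure_of_invariant`). The convergence is setwise, which is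
stronger than weak convergence.

For the law of large numbers, `skewShift` acts on pairs of an environment and a trajectory by
looking at both from the position after one step. It preserves the joint law if the environment is
distributed according to the invariant measure, and it is ergodic: the conditional probability of
an invariant event given the environment is a bounded harmonic function, hence constant
(`exists_ae_eq_const_of_harmonic`), so that the event is independent of the trajectory and in
particular of itself (`ergodic_skewShift`). As `S n` is a Birkhoff sum of `S 1`, Birkhoff's theorem
(`tendsto_birkhoffSum_div`) applies. The speed is bounded below by the inverse of the bound on the
Green function, because the time spent in `[0, n]` is at most linear in `n` (`inv_le_speed`); this
bound is uniform in the finite truncation levels and so passes to the limit.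
-/

namespace RWRE

/-! ### Trajectories and cylinders -/

/-- The cylinder of trajectories that agree with `a` up to time `n`. -/
def cyl (a : ℕ → ℤ) (n : ℕ) : Set (ℕ → ℤ) := {S | ∀ i ≤ n, S i = a i}

theorem cyl_eq_preimage (a : ℕ → ℤ) (n : ℕ) :
    cyl a n = Preorder.frestrictLe (π := fun _ : ℕ => ℤ) n ⁻¹' {Preorder.frestrictLe n a} := by
  ext S
  simp only [cyl, Set.mem_ofPred_eq, Set.mem_preimage, Set.mem_singleton_iff]
  constructor
  · intro h
    funext i
    exact h i.1 (Finset.mem_Iic.mp i.2)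
  · intro h i hi
    exact congrFun h ⟨i, Finset.mem_Iic.mpr hi⟩

theorem measurableSet_cyl (a : ℕ → ℤ) (n : ℕ) : MeasurableSet (cyl a n) := by
  rw [cyl_eq_preimage]
  exact (Preorder.measurable_frestrictLe n) (measurableSet_singleton _)

/-- An extension by `0` to all times of a trajectory defined up to time `n`. -/
def extendPath {n : ℕ} (h : (i : Finset.Iic n) → ℤ) : ℕ → ℤ :=
  fun i => if hi : i ≤ n then h ⟨i, Finset.mem_Iic.mpr hi⟩ else 0

theorem frestrictLe_extendPath {n : ℕ} (h : (i : Finset.Iic n) → ℤ) :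
    Preorder.frestrictLe (π := fun _ : ℕ => ℤ) n (extendPath h) = h := by
  funext i
  have : i.1 ≤ n := Finset.mem_Iic.mp i.2
  simp [this, extendPath]

theorem measure_cylinder_eq_tsum (μ : Measure (ℕ → ℤ)) {n : ℕ}
    {B : Set ((i : Finset.Iic n) → ℤ)} (hB : MeasurableSet B) :
    μ (cylinder (Finset.Iic n) B) = ∑' h, B.indicator (fun h => μ (cyl (extendPath h) n)) h := by
  have h1 : μ (cylinder (Finset.Iic n) B) = μ.map (Preorder.frestrictLe n) B := by
    rw [Measure.map_apply (Preorder.measurable_frestrictLe n) hB]; rfl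
  rw [h1, ← Measure.tsum_indicator_apply_singleton _ B hB]
  refine tsum_congr fun h => ?_
  by_cases hh : h ∈ B
  · rw [Set.indicator_of_mem hh, Set.indicator_of_mem hh, cyl_eq_preimage,
      Measure.map_apply (Preorder.measurable_frestrictLe n) (measurableSet_singleton _),
      frestrictLe_extendPath]
  · rw [Set.indicator_of_notMem hh, Set.indicator_of_notMem hh]

/-- Finite measures on trajectories are determined by their values on cylinders. -/
theorem ext_of_cyl {μ ν : Measure (ℕ → ℤ)} [IsFiniteMeasure μ]
    (h : ∀ a n, μ (cyl a n) = ν (cyl a n)) : μ = ν := by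
  have key : ∀ t ∈ measurableCylinders (fun _ : ℕ => ℤ), μ t = ν t := by
    intro t ht
    obtain ⟨n, B, hB, rfl⟩ : ∃ N S, MeasurableSet S ∧ t = cylinder (Finset.Iic N) S := by
      simpa [measurableCylinders_nat] using ht
    simp only [measure_cylinder_eq_tsum _ hB, h]
  exact ext_of_generate_finite (measurableCylinders (fun _ : ℕ => ℤ))
    generateFrom_measurableCylinders.symm isPiSystem_measurableCylinders key
    (key _ (by simpa using
      cylinder_mem_measurableCylinders (α := fun _ : ℕ => ℤ) ∅ Set.univ .univ))

/-- A family of laws on trajectories is measurable if its values on cylinders are. -/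
theorem measurable_of_cyl {α : Type*} [MeasurableSpace α] {κ : α → Measure (ℕ → ℤ)}
    [∀ a, IsProbabilityMeasure (κ a)] (h : ∀ b n, Measurable fun a => κ a (cyl b n)) :
    Measurable κ := by
  refine Measurable.measure_of_isPiSystem_of_isProbabilityMeasure
    (S := measurableCylinders (fun _ : ℕ => ℤ)) generateFrom_measurableCylinders.symm
    isPiSystem_measurableCylinders ?_
  intro t ht
  obtain ⟨n, B, hB, rfl⟩ : ∃ N S, MeasurableSet S ∧ t = cylinder (Finset.Iic N) S := by
      simpa [measurableCylinders_nat] using ht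
  simp only [measure_cylinder_eq_tsum _ hB]
  refine Measurable.tsum fun b => ?_
  by_cases hb : b ∈ B
  · simpa only [Set.indicator_of_mem hb] using h _ _
  · simp only [Set.indicator_of_notMem hb, measurable_const]

/-! ### The quenched law -/

theorem quenchedLaw_cyl_zero (ω : Env) (x : ℤ) (a : ℕ → ℤ) :
    quenchedLaw ω x (cyl a 0) = if a 0 = x then 1 else 0 := by
  rw [cyl_eq_preimage,
    ← Measure.map_apply (Preorder.measurable_frestrictLe 0) (measurableSet_singleton _),
    quenchedLaw, Kernel.traj_map_frestrictLe_apply, Kernel.partialTraj_self, Kernel.id_apply,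
    Measure.dirac_apply' _ (measurableSet_singleton _)]
  simp only [Set.indicator_apply, Set.mem_singleton_iff, Pi.one_apply]
  congr 1
  rw [eq_iff_iff]
  constructor
  · intro h; exact (congrFun h ⟨0, by simp⟩).symm
  · intro h; funext i
    have : i.1 = 0 := Nat.le_zero.mp (Finset.mem_Iic.mp i.2)
    simp [this, h]

instance (ω : Env) (x : ℤ) : IsProbabilityMeasure (quenchedLaw ω x) := by
  unfold quenchedLaw; infer_instance

instance (ϱ : ℕ∞) (ω : Env) : IsProbabilityMeasure (walkLaw ϱ ω) := by
  unfold walkLaw; infer_instance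

theorem stepKernel_singleton (ω : Env) (x y : ℤ) :
    stepKernel ω x {y} = ω.1 x (y - x) := by
  change ((jumpPMF ω x).map (fun y => x + y)).toMeasure {y} = _
  rw [PMF.toMeasure_apply_singleton _ _ (measurableSet_singleton _), PMF.map_apply,
    tsum_eq_single (y - x)]
  · simp [jumpPMF]; rfl
  · intro b hb
    rw [if_neg]
    intro h
    exact hb (by omega)

theorem quenchedLaw_cyl_succ (ω : Env) (x : ℤ) (a : ℕ → ℤ) (n : ℕ) :
    quenchedLaw ω x (cyl a (n + 1))
      = quenchedLaw ω x (cyl a n) * ω.1 (a n) (a (n + 1) - a n) := by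
  have hset : cyl a (n + 1) = (fun S : ℕ → ℤ => (Preorder.frestrictLe n S, S (n + 1))) ⁻¹'
      ({Preorder.frestrictLe (π := fun _ : ℕ => ℤ) n a} ×ˢ {a (n + 1)}) := by
    ext S
    have h1 : S ∈ cyl a n ↔ Preorder.frestrictLe (π := fun _ : ℕ => ℤ) n S
        = Preorder.frestrictLe n a := by rw [cyl_eq_preimage]; rfl
    simp only [Set.mem_preimage, Set.mem_prod, Set.mem_singleton_iff, ← h1]
    simp only [cyl, Set.mem_ofPred_eq, Nat.le_succ_iff]
    constructor
    · intro h
      exact ⟨fun i hi => h i (Or.inl hi), h _ (Or.inr rfl)⟩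
    · rintro ⟨h, h'⟩ i (hi | rfl)
      · exact h i hi
      · exact h'
  have hm : Measurable fun S : ℕ → ℤ =>
      (Preorder.frestrictLe (π := fun _ : ℕ => ℤ) n S, S (n + 1)) :=
    (Preorder.measurable_frestrictLe n).prodMk (measurable_pi_apply _)
  rw [hset, ← Measure.map_apply hm ((measurableSet_singleton _).prod (measurableSet_singleton _)),
    quenchedLaw, ← Kernel.partialTraj_compProd_eq_map_traj (Nat.zero_le n),
    Measure.compProd_apply_prod (measurableSet_singleton _) (measurableSet_singleton _),
    lintegral_singleton, mul_comm, ← Kernel.traj_map_frestrictLe_apply,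
    Measure.map_apply (Preorder.measurable_frestrictLe n) (measurableSet_singleton _),
    ← cyl_eq_preimage]
  congr 1
  exact stepKernel_singleton ω (a n) (a (n + 1))

/-- The probability of a path up to time `n` is the product of its transition probabilities. -/
theorem quenchedLaw_cyl (ω : Env) (x : ℤ) (a : ℕ → ℤ) (n : ℕ) :
    quenchedLaw ω x (cyl a n) = (if a 0 = x then 1 else 0) *
      ∏ i ∈ Finset.range n, (ω.1 (a i) (a (i + 1) - a i) : ℝ≥0∞) := by
  induction n with
  | zero => simp [quenchedLaw_cyl_zero]
  | succ n ih => rw [quenchedLaw_cyl_succ, ih, Finset.prod_range_succ, mul_assoc]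

theorem measurable_quenchedLaw (x : ℤ) : Measurable fun ω => quenchedLaw ω x := by
  refine measurable_of_cyl fun b n => ?_
  simp only [quenchedLaw_cyl]
  exact (Finset.measurable_prod _ fun i _ =>
    (measurable_coord _ _).coe_nnreal_ennreal).const_mul _

theorem measurable_truncate (ϱ : ℕ∞) : Measurable (truncate ϱ) :=
  Measurable.subtype_mk (measurable_pi_lambda _ fun x => measurable_pi_lambda _ fun y =>
    measurable_truncate_coord ϱ x y)

theorem measurable_walkLaw (ϱ : ℕ∞) : Measurable (walkLaw ϱ) :=
  (measurable_quenchedLaw 0).comp (measurable_truncate ϱ)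

@[simp] theorem shift_coord (z : ℤ) (ω : Env) (x y : ℤ) : (shift z ω).1 x y = ω.1 (x + z) y := rfl

theorem shift_shift (z w : ℤ) (ω : Env) : shift z (shift w ω) = shift (z + w) ω := by
  apply Subtype.ext
  funext x y
  simp [add_assoc]

theorem shift_zero (ω : Env) : shift 0 ω = ω := by
  apply Subtype.ext
  funext x y
  simp

theorem truncate_shift (ϱ : ℕ∞) (z : ℤ) (ω : Env) :
    truncate ϱ (shift z ω) = shift z (truncate ϱ ω) := rfl

/-- The trajectory that starts at `0` and from time `1` on follows `S` translated by `y`. -/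
def consWalk (y : ℤ) (S : ℕ → ℤ) : ℕ → ℤ
  | 0 => 0
  | n + 1 => y + S n

theorem measurable_consWalk (y : ℤ) : Measurable (consWalk y) := by
  refine measurable_pi_lambda _ fun n => ?_
  cases n with
  | zero => exact measurable_const
  | succ n =>
    have h : Measurable fun S : ℕ → ℤ => S n := measurable_pi_apply n
    exact h.const_add y

theorem consWalk_preimage_cyl_succ (y : ℤ) (a : ℕ → ℤ) (n : ℕ) :
    consWalk y ⁻¹' cyl a (n + 1) =
      if a 0 = 0 then cyl (fun i => a (i + 1) - y) n else ∅ := by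
  ext S
  split_ifs with h0
  · simp only [Set.mem_preimage, cyl, Set.mem_ofPred_eq]
    constructor
    · intro h i hi
      have := h (i + 1) (by omega)
      simp only [consWalk] at this
      omega
    · intro h i hi
      cases i with
      | zero => exact h0.symm
      | succ i =>
        have := h i (by omega)
        simp only [consWalk]
        omega
  · simp only [Set.mem_preimage, cyl, Set.mem_ofPred_eq, Set.mem_empty_iff_false, iff_false]
    intro h
    exact h0 (h 0 (by omega)).symm

theorem consWalk_preimage_cyl_zero (y : ℤ) (a : ℕ → ℤ) :
    consWalk y ⁻¹' cyl a 0 = if a 0 = 0 then Set.univ else ∅ := by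
  ext S
  split_ifs with h0
  · simp [cyl, consWalk, h0]
  · simp [cyl, consWalk, Ne.symm h0]

theorem tsum_coord (ω : Env) (x : ℤ) : ∑' y, (ω.1 x y : ℝ≥0∞) = 1 := by
  rw [← ENNReal.coe_tsum (ω.2 x).summable, (ω.2 x).tsum_eq, ENNReal.coe_one]

/-- The Markov property at time `1`: after a first step `y` the walk is a walk from the origin in
the environment `shift y ω`, translated by `y`. -/
theorem quenchedLaw_first_step (ω : Env) :
    quenchedLaw ω 0 = Measure.sum fun y =>
      (ω.1 0 y : ℝ≥0∞) • (quenchedLaw (shift y ω) 0).map (consWalk y) := by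
  refine ext_of_cyl fun a n => ?_
  rw [Measure.sum_apply _ (measurableSet_cyl a n)]
  simp only [Measure.smul_apply, smul_eq_mul,
    Measure.map_apply (measurable_consWalk _) (measurableSet_cyl a n)]
  cases n with
  | zero =>
    simp only [consWalk_preimage_cyl_zero, quenchedLaw_cyl_zero]
    split_ifs with h0
    · simp [tsum_coord]
    · simp
  | succ n =>
    simp only [consWalk_preimage_cyl_succ]
    rw [quenchedLaw_cyl]
    split_ifs with h0
    · rw [tsum_eq_single (a 1)]
      · rw [quenchedLaw_cyl, Finset.prod_range_succ']
        simp only [zero_add, sub_self, if_true, one_mul, h0, sub_zero, shift_coord]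
        rw [mul_comm]
        congr 1
        refine Finset.prod_congr rfl fun i _ => ?_
        rw [sub_add_cancel, sub_sub_sub_cancel_right]
      · intro y hy
        rw [quenchedLaw_cyl, if_neg]
        · simp
        · simp only [zero_add]
          omega
    · simp

theorem quenchedLaw_apply_first_step (ω : Env) {A : Set (ℕ → ℤ)} (hA : MeasurableSet A) :
    quenchedLaw ω 0 A
      = ∑' y, (ω.1 0 y : ℝ≥0∞) * quenchedLaw (shift y ω) 0 (consWalk y ⁻¹' A) := by
  conv_lhs => rw [quenchedLaw_first_step, Measure.sum_apply _ hA]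
  refine tsum_congr fun y => ?_
  rw [Measure.smul_apply, smul_eq_mul, Measure.map_apply (measurable_consWalk y) hA]

theorem ae_quenchedLaw_zero (ω : Env) : ∀ᵐ S ∂(quenchedLaw ω 0), S 0 = 0 := by
  have h := quenchedLaw_cyl_zero ω 0 (fun _ => 0)
  rw [if_pos rfl] at h
  have h2 := (prob_compl_eq_zero_iff (measurableSet_cyl (fun _ => 0) 0)).mpr h
  rw [ae_iff]
  convert h2 using 2
  ext S
  simp [cyl]

/-! ### The Green function of the walk -/

/-- The `n`-step transition probabilities of the walk in the environment `ω`. -/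
noncomputable def nStep (ω : Env) : ℕ → ℤ → ℤ → ℝ≥0∞
  | 0, x, y => if x = y then 1 else 0
  | n + 1, x, y => ∑' z, (ω.1 x z : ℝ≥0∞) * nStep ω n (x + z) y

/-- The Green function: the expected number of visits to `y` of the walk started from `x`. -/
noncomputable def green (ω : Env) (x y : ℤ) : ℝ≥0∞ := ∑' n, nStep ω n x y

theorem nStep_shift (z : ℤ) (ω : Env) (n : ℕ) (x y : ℤ) :
    nStep (shift z ω) n x y = nStep ω n (x + z) (y + z) := by
  induction n generalizing x with
  | zero => simp [nStep]
  | succ n ih =>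
    simp only [nStep, ih, shift_coord]
    refine tsum_congr fun w => ?_
    rw [add_right_comm]

theorem green_shift (z : ℤ) (ω : Env) (x y : ℤ) :
    green (shift z ω) x y = green ω (x + z) (y + z) := by
  simp only [green, nStep_shift]

theorem measurable_nStep (n : ℕ) (x y : ℤ) : Measurable fun ω : Env => nStep ω n x y := by
  induction n generalizing x with
  | zero => exact measurable_const
  | succ n ih =>
    exact Measurable.tsum fun z => (measurable_coord _ _).coe_nnreal_ennreal.mul (ih _)

theorem measurable_green (x y : ℤ) : Measurable fun ω : Env => green ω x y :=
  Measurable.tsum fun n => measurable_nStep n x y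

theorem measurableSet_coord_eq (n : ℕ) (y : ℤ) : MeasurableSet {S : ℕ → ℤ | S n = y} :=
  (measurable_pi_apply (X := fun _ : ℕ => ℤ) n) (measurableSet_singleton y)

theorem quenchedLaw_coord_eq (ω : Env) (n : ℕ) (y : ℤ) :
    quenchedLaw ω 0 {S | S n = y} = nStep ω n 0 y := by
  induction n generalizing ω y with
  | zero =>
    have h : {S : ℕ → ℤ | S 0 = y} = cyl (fun _ => y) 0 := by ext S; simp [cyl]
    rw [h, quenchedLaw_cyl_zero]
    simp [nStep, eq_comm]
  | succ n ih =>
    rw [quenchedLaw_apply_first_step _ (measurableSet_coord_eq _ _), nStep]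
    refine tsum_congr fun z => ?_
    have h : consWalk z ⁻¹' {S | S (n + 1) = y} = {S | S n = y - z} := by
      ext S
      simp only [Set.mem_preimage, Set.mem_ofPred_eq, consWalk]
      omega
    rw [h, ih, nStep_shift, zero_add, sub_add_cancel]

theorem lintegral_visits (ω : Env) (x : ℤ) :
    ∫⁻ S, visits S x ∂(quenchedLaw ω 0) = green ω 0 x := by
  have hm : ∀ k : ℕ, Measurable fun S : ℕ → ℤ => if S k = x then (1 : ℝ≥0∞) else 0 := fun k =>
    Measurable.ite (measurableSet_coord_eq k x) measurable_const measurable_const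
  simp only [visits]
  rw [lintegral_tsum fun k => (hm k).aemeasurable]
  refine tsum_congr fun k => ?_
  rw [← quenchedLaw_coord_eq, ← lintegral_indicator_one (measurableSet_coord_eq k x)]
  refine lintegral_congr fun S => ?_
  simp [Set.indicator_apply]

theorem tsum_sub_coord (ω : Env) (x : ℤ) : ∑' y, (ω.1 x (y - x) : ℝ≥0∞) = 1 := by
  rw [← tsum_coord ω x]
  exact (Equiv.subRight x).tsum_eq fun y => (ω.1 x y : ℝ≥0∞)

/-- The `n`-step transition probabilities, decomposed at the last step. -/
theorem nStep_succ_last (ω : Env) (n : ℕ) (x y : ℤ) :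
    nStep ω (n + 1) x y = ∑' z, nStep ω n x z * (ω.1 z (y - z) : ℝ≥0∞) := by
  induction n generalizing x with
  | zero =>
    have h1 : nStep ω (0 + 1) x y = (ω.1 x (y - x) : ℝ≥0∞) := by
      rw [nStep, tsum_eq_single (y - x)]
      · simp [nStep]
      · intro z hz
        rw [nStep, if_neg (by omega), mul_zero]
    rw [h1, tsum_eq_single x]
    · simp [nStep]
    · intro z hz
      rw [nStep, if_neg (Ne.symm hz), zero_mul]
  | succ n ih =>
    rw [nStep]
    simp only [ih]
    rw [← (tsum_congr fun w => ENNReal.tsum_mul_left)]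
    rw [ENNReal.tsum_comm]
    refine tsum_congr fun z => ?_
    rw [nStep, ← ENNReal.tsum_mul_right]
    refine tsum_congr fun w => ?_
    rw [mul_assoc]

theorem green_last_step (ω : Env) (x y : ℤ) :
    green ω x y = (if x = y then 1 else 0) + ∑' z, green ω x z * (ω.1 z (y - z) : ℝ≥0∞) := by
  rw [green, tsum_eq_zero_add' ENNReal.summable]
  congr 1
  simp only [nStep_succ_last, green, ← ENNReal.tsum_mul_right]
  rw [ENNReal.tsum_comm]

/-- Each jump from `z` to `y` contributes a visit to `y`. -/
theorem green_mul_le (ω : Env) (x y z : ℤ) :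
    green ω x z * (ω.1 z (y - z) : ℝ≥0∞) ≤ green ω x y := by
  rw [green_last_step ω x y]
  exact (ENNReal.le_tsum z).trans le_add_self

/-- The maximum principle: a site is visited most often by the walk that starts there. -/
theorem green_le_diag (ω : Env) (x y : ℤ) : green ω x y ≤ green ω y y := by
  -- induction on the time horizon avoids stopping times
  have h : ∀ N : ℕ, ∀ x, ∑ n ∈ Finset.range N, nStep ω n x y
      ≤ ∑ n ∈ Finset.range N, nStep ω n y y := by
    intro N
    induction N with
    | zero => intro x; simp
    | succ N ih =>
      intro x
      by_cases hxy : x = y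
      · rw [hxy]
      rw [Finset.sum_range_succ', nStep, if_neg hxy, add_zero]
      simp only [nStep]
      calc ∑ n ∈ Finset.range N, ∑' z, (ω.1 x z : ℝ≥0∞) * nStep ω n (x + z) y
          = ∑' z, (ω.1 x z : ℝ≥0∞) * ∑ n ∈ Finset.range N, nStep ω n (x + z) y := by
            rw [← Summable.tsum_finsetSum fun _ _ => ENNReal.summable]
            simp only [Finset.mul_sum]
        _ ≤ ∑' z, (ω.1 x z : ℝ≥0∞) * ∑ n ∈ Finset.range N, nStep ω n y y :=
            ENNReal.tsum_le_tsum fun z => mul_le_mul_right (ih _) _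
        _ = ∑ n ∈ Finset.range N, nStep ω n y y := by
            rw [ENNReal.tsum_mul_right, tsum_coord, one_mul]
        _ ≤ _ := Finset.sum_le_sum_of_subset (Finset.range_mono (Nat.le_succ N))
  rw [green, ENNReal.tsum_eq_iSup_nat]
  exact iSup_le fun N => (h N x).trans (ENNReal.sum_le_tsum _)

theorem tsum_nonpos_eq (f : ℤ → ℝ≥0∞) :
    ∑' y : ℤ, (if y ≤ 0 then f y else 0) = ∑' m : ℕ, f (-(m : ℤ)) := by
  have hinj : Function.Injective fun m : ℕ => -(m : ℤ) := fun a b h => by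
    simpa using h
  rw [← hinj.tsum_eq]
  · refine tsum_congr fun m => ?_
    simp
  · intro y hy
    have : y ≤ 0 := by
      by_contra h
      simp [h] at hy
    exact ⟨y.natAbs, by simp only; omega⟩

/-- If the expected time spent in `(-∞, 0]` is finite, then the walk leaves this half-line, by a
jump that crosses from one of the sites `-m` to the positive half-line. -/
theorem one_le_tsum_green_mul_exit (ω : Env) {x : ℤ} (hx : x ≤ 0)
    (hfin : ∑' m : ℕ, green ω x (-(m : ℤ)) ≠ ∞) :
    1 ≤ ∑' m : ℕ, green ω x (-(m : ℤ)) *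
      ∑' y : ℤ, (if (m : ℕ) + 1 ≤ y.natAbs then (ω.1 (-(m : ℤ)) y : ℝ≥0∞) else 0) := by
  set r : ℕ → ℝ≥0∞ := fun m =>
    ∑' y : ℤ, (if (m : ℕ) + 1 ≤ y.natAbs then (ω.1 (-(m : ℤ)) y : ℝ≥0∞) else 0) with hr
  -- `R n` is the probability to be in `(-∞, 0]` at time `n`
  set R : ℕ → ℝ≥0∞ := fun n => ∑' m : ℕ, nStep ω n x (-(m : ℤ)) with hR
  have hR0 : 1 ≤ R 0 := by
    refine le_trans ?_ (ENNReal.le_tsum x.natAbs)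
    rw [nStep, if_pos (by omega)]
  have hRsum : ∑' n, R n ≠ ∞ := by
    rw [hR, ENNReal.tsum_comm]
    exact hfin
  have hlim : Tendsto R atTop (𝓝 0) := ENNReal.tendsto_atTop_zero_of_tsum_ne_top hRsum
  -- the mass in `(-∞, 0]` that is not there at the next step has jumped over `0`
  have hstep : ∀ n, R n ≤ R (n + 1) + ∑' m : ℕ, nStep ω n x (-(m : ℤ)) * r m := by
    intro n
    have h1 : ∑' m : ℕ, nStep ω n x (-(m : ℤ)) *
        ∑' y : ℤ, (if y ≤ 0 then (ω.1 (-(m : ℤ)) (y - (-(m : ℤ))) : ℝ≥0∞) else 0) ≤ R (n + 1) := by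
      simp only [tsum_nonpos_eq, ← ENNReal.tsum_mul_left]
      rw [ENNReal.tsum_comm]
      refine ENNReal.tsum_le_tsum fun k => ?_
      rw [nStep_succ_last]
      refine le_trans (le_of_eq ?_) (ENNReal.tsum_comp_le_tsum_of_injective
        (f := fun m : ℕ => -(m : ℤ)) (fun a b h => by simpa using h) _)
      rfl
    have h2 : ∀ m : ℕ, 1 ≤
        (∑' y : ℤ, (if y ≤ 0 then (ω.1 (-(m : ℤ)) (y - (-(m : ℤ))) : ℝ≥0∞) else 0)) + r m := by
      intro m
      have h3 : r m = ∑' y : ℤ, (if (m : ℕ) + 1 ≤ (y - (-(m : ℤ))).natAbs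
          then (ω.1 (-(m : ℤ)) (y - (-(m : ℤ))) : ℝ≥0∞) else 0) :=
        ((Equiv.subRight (-(m : ℤ))).tsum_eq fun y : ℤ => if (m : ℕ) + 1 ≤ y.natAbs
          then (ω.1 (-(m : ℤ)) y : ℝ≥0∞) else 0).symm
      rw [h3, ← ENNReal.tsum_add, ← tsum_sub_coord ω (-(m : ℤ))]
      refine ENNReal.tsum_le_tsum fun y => ?_
      by_cases hy : y ≤ 0
      · rw [if_pos hy]
        exact le_self_add
      · rw [if_neg hy, zero_add, if_pos (by omega)]
    calc R n = ∑' m : ℕ, nStep ω n x (-(m : ℤ)) * 1 := by simp [hR]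
      _ ≤ ∑' m : ℕ, nStep ω n x (-(m : ℤ)) * ((∑' y : ℤ, (if y ≤ 0 then
            (ω.1 (-(m : ℤ)) (y - (-(m : ℤ))) : ℝ≥0∞) else 0)) + r m) :=
          ENNReal.tsum_le_tsum fun m => by gcongr; exact h2 m
      _ ≤ _ := by
          simp only [mul_add]
          rw [ENNReal.tsum_add]
          gcongr
  have hsum : ∀ N, R 0 ≤ R N + ∑ n ∈ Finset.range N, ∑' m : ℕ, nStep ω n x (-(m : ℤ)) * r m := by
    intro N
    induction N with
    | zero => simp
    | succ N ih =>
      refine ih.trans ?_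
      rw [Finset.sum_range_succ, add_comm (∑ n ∈ Finset.range N, _), ← add_assoc]
      gcongr
      exact hstep N
  have htot : ∑' m : ℕ, green ω x (-(m : ℤ)) * r m
      = ∑' n, ∑' m : ℕ, nStep ω n x (-(m : ℤ)) * r m := by
    rw [ENNReal.tsum_comm]
    simp only [green, ENNReal.tsum_mul_right]
  rw [htot]
  refine hR0.trans ?_
  have h4 : ∀ N, R 0 ≤ R N + ∑' n, ∑' m : ℕ, nStep ω n x (-(m : ℤ)) * r m := fun N =>
    (hsum N).trans (by gcongr; exact ENNReal.sum_le_tsum _)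
  have h5 := ge_of_tendsto' (hlim.add_const _) h4
  simpa using h5

section bounds

variable {ω : Env} {g t : ℕ → ℝ≥0∞}

theorem green_le_zero_apply (hd : ∀ x y, y ≤ x → green ω x y ≤ g (x - y).natAbs) (x y : ℤ) :
    green ω x y ≤ g 0 :=
  (green_le_diag ω x y).trans (by simpa using hd y y le_rfl)

/-- The expected time spent in `(-∞, n]` grows at most linearly in `n`. -/
theorem tsum_green_le (hd : ∀ x y, y ≤ x → green ω x y ≤ g (x - y).natAbs) (x : ℤ) (k : ℕ) :
    ∑' m : ℕ, green ω x (x + k - m) ≤ k * g 0 + ∑' m, g m := by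
  rw [← ENNReal.summable.sum_add_tsum_nat_add' (k := k)]
  gcongr with m
  · calc ∑ m ∈ Finset.range k, green ω x (x + k - m) ≤ ∑ m ∈ Finset.range k, g 0 :=
        Finset.sum_le_sum fun m _ => green_le_zero_apply hd _ _
      _ = k * g 0 := by simp
  · refine (hd _ _ (by push_cast; omega)).trans (le_of_eq ?_)
    congr 1
    push_cast
    omega

/-- A walk started to the left of `0` makes a number of visits to `0` whose expectation is bounded
below: it jumps over the sites `-M + 1, …, 0` with probability at most `1/2`, and from each of them
it steps to `0` with probability at least `ε ^ M`. -/
theorem le_mul_green (hd : ∀ x y, y ≤ x → green ω x y ≤ g (x - y).natAbs)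
    (hg : ∑' m, g m ≠ ∞)
    (ht : ∀ x, ∀ s : ℕ, 1 ≤ s → ∑' y : ℤ, (if s ≤ y.natAbs then (ω.1 x y : ℝ≥0∞) else 0) ≤ t s)
    {ε : ℝ≥0∞} (hε1 : ε ≤ 1) (hε : ∀ x, ε ≤ ω.1 x 1) {M : ℕ}
    (hM : g 0 * ∑' m, t (m + M + 1) ≤ 2⁻¹) (k : ℕ) :
    ε ^ M * 2⁻¹ ≤ M * green ω (-(k : ℤ)) 0 := by
  have hfin : ∑' m : ℕ, green ω (-(k : ℤ)) (-(m : ℤ)) ≠ ∞ := by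
    have h := tsum_green_le hd (-(k : ℤ)) k
    simp only [neg_add_cancel, zero_sub] at h
    refine ne_top_of_le_ne_top ?_ h
    have : g 0 ≠ ∞ := ENNReal.ne_top_of_tsum_ne_top hg 0
    finiteness
  have h1 := one_le_tsum_green_mul_exit ω (x := -(k : ℤ)) (by omega) hfin
  rw [← ENNReal.summable.sum_add_tsum_nat_add' (k := M)] at h1
  have h2 : (1 : ℝ≥0∞) ≤ ∑ m ∈ Finset.range M, green ω (-(k : ℤ)) (-(m : ℤ)) + 2⁻¹ := by
    refine h1.trans (add_le_add (Finset.sum_le_sum fun m _ => ?_) (le_trans ?_ hM))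
    · refine mul_le_of_le_one_right' ?_
      rw [← tsum_coord ω (-(m : ℤ))]
      refine ENNReal.tsum_le_tsum fun y => ?_
      split_ifs <;> simp
    · rw [← ENNReal.tsum_mul_left]
      refine ENNReal.tsum_le_tsum fun m => ?_
      gcongr
      · exact green_le_zero_apply hd _ _
      · exact ht _ (m + M + 1) (by omega)
  have h3 : (2⁻¹ : ℝ≥0∞) ≤ ∑ m ∈ Finset.range M, green ω (-(k : ℤ)) (-(m : ℤ)) := by
    rw [← ENNReal.inv_two_add_inv_two] at h2
    exact (ENNReal.add_le_add_iff_right (by simp)).mp h2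
  -- by ellipticity, visits to `-m` are followed by visits to `0` in `m` steps
  have h4 : ∀ m : ℕ, ε ^ m * green ω (-(k : ℤ)) (-(m : ℤ)) ≤ green ω (-(k : ℤ)) 0 := by
    intro m
    induction m with
    | zero => simp
    | succ m ih =>
      refine le_trans ?_ ih
      rw [pow_succ, mul_assoc]
      gcongr
      rw [mul_comm]
      refine le_trans ?_ (green_mul_le ω (-(k : ℤ)) (-(m : ℤ)) (-((m + 1 : ℕ) : ℤ)))
      gcongr
      have : -(m : ℤ) - -((m + 1 : ℕ) : ℤ) = 1 := by push_cast; ring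
      rw [this]
      exact hε _
  calc ε ^ M * 2⁻¹ ≤ ε ^ M * ∑ m ∈ Finset.range M, green ω (-(k : ℤ)) (-(m : ℤ)) := by gcongr
    _ = ∑ m ∈ Finset.range M, ε ^ M * green ω (-(k : ℤ)) (-(m : ℤ)) := Finset.mul_sum _ _ _
    _ ≤ ∑ m ∈ Finset.range M, green ω (-(k : ℤ)) 0 := by
        refine Finset.sum_le_sum fun m hm => le_trans ?_ (h4 m)
        gcongr ?_ * _
        exact pow_le_pow_right_of_le_one' hε1 (Finset.mem_range.mp hm).le
    _ = M * green ω (-(k : ℤ)) 0 := by simp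

end bounds

/-! ### Limits of uniformly dominated measures -/

section domination

variable {α ι : Type*} [MeasurableSpace α] {P : Measure α} [IsFiniteMeasure P] {C : ℝ≥0}

/-- For measures dominated by `C • P`, setwise convergence implies convergence of the integrals of
all `P`-integrable functions. -/
theorem tendsto_integral_of_tendsto_measure {ν : ι → Measure α} {μ : Measure α} {l : Filter ι}
    (hν : ∀ᶠ i in l, ν i ≤ C • P) (hμ : μ ≤ C • P)
    (h : ∀ A, MeasurableSet A → Tendsto (fun i => ν i A) l (𝓝 (μ A)))
    {φ : α → ℝ} (hφ : Integrable φ P) :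
    Tendsto (fun i => ∫ x, φ x ∂(ν i)) l (𝓝 (∫ x, φ x ∂μ)) := by
  have hint : ∀ {m : Measure α}, m ≤ C • P → ∀ {ψ : α → ℝ}, Integrable ψ P → Integrable ψ m :=
    fun hm ψ hψ => (hψ.smul_measure_nnreal (c := C)).mono_measure hm
  have hnorm : ∀ {m : Measure α}, m ≤ C • P → ∀ {ψ : α → ℝ}, Integrable ψ P →
      |∫ x, ψ x ∂m| ≤ C * ∫ x, |ψ x| ∂P := by
    intro m hm ψ hψ
    calc |∫ x, ψ x ∂m| ≤ ∫ x, |ψ x| ∂m := abs_integral_le_integral_abs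
      _ ≤ ∫ x, |ψ x| ∂(C • P) := integral_mono_measure hm (ae_of_all _ fun _ => abs_nonneg _)
          (hψ.abs.smul_measure_nnreal)
      _ = C * ∫ x, |ψ x| ∂P := by rw [integral_smul_nnreal_measure]; rfl
  refine Integrable.induction (P := fun φ : α → ℝ =>
    Tendsto (fun i => ∫ x, φ x ∂(ν i)) l (𝓝 (∫ x, φ x ∂μ))) ?_ ?_ ?_ ?_ hφ
  · intro c s hs _
    simp only [integral_indicator_const c hs]
    refine Tendsto.smul_const ?_ c
    have hfin : μ s ≠ ∞ := ne_top_of_le_ne_top (measure_ne_top (C • P) s) (hμ s)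
    exact (ENNReal.tendsto_toReal hfin).comp (h s hs)
  · intro f g _ hf hg hf' hg'
    have e1 : ∫ x, (f + g) x ∂μ = ∫ x, f x ∂μ + ∫ x, g x ∂μ :=
      integral_add (hint hμ hf) (hint hμ hg)
    rw [e1]
    refine (hf'.add hg').congr' ?_
    filter_upwards [hν] with i hi
    exact (integral_add (hint hi hf) (hint hi hg)).symm
  · rw [isClosed_iff_clusterPt]
    intro f hf
    change Tendsto _ _ _
    rw [Metric.tendsto_nhds]
    intro ε hε
    rw [← mem_closure_iff_clusterPt, Metric.mem_closure_iff] at hf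
    obtain ⟨g, hg, hfg⟩ := hf (ε / (3 * (C + 1))) (by positivity)
    have hC : (C : ℝ) * dist f g < ε / 3 := by
      have : (C : ℝ) * dist f g ≤ C * (ε / (3 * (C + 1))) := by gcongr
      refine this.trans_lt ?_
      rw [mul_div_assoc', div_lt_div_iff₀ (by positivity) (by positivity)]
      nlinarith [C.2]
    have hd : ∀ {m : Measure α}, m ≤ C • P → |∫ x, f x ∂m - ∫ x, g x ∂m| < ε / 3 := by
      intro m hm
      rw [← integral_sub (hint hm (L1.integrable_coeFn f)) (hint hm (L1.integrable_coeFn g))]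
      refine (hnorm hm ((L1.integrable_coeFn f).sub (L1.integrable_coeFn g))).trans_lt ?_
      rwa [L1.dist_eq_integral_dist] at hC
    filter_upwards [hν, (Metric.tendsto_nhds.mp hg) (ε / 3) (by positivity)] with i hi h2
    have h1 := hd hi
    have h3 := hd hμ
    rw [Real.dist_eq] at h2 ⊢
    rw [abs_lt] at *
    constructor <;> linarith
  · intro f g hfg _ hf
    have e : ∀ {m : Measure α}, m ≤ C • P → ∫ x, g x ∂m = ∫ x, f x ∂m := fun hm =>
      integral_congr_ae (Measure.absolutelyContinuous_of_le_smul hm |>.ae_le hfg.symm)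
    rw [e hμ]
    refine hf.congr' ?_
    filter_upwards [hν] with i hi
    exact (e hi).symm

/-- Measures dominated by a multiple of a fixed finite measure are sequentially compact for
setwise convergence; the statement is in terms of ultrafilters. -/
theorem exists_tendsto_measure_of_le (ν : ι → Measure α) (U : Ultrafilter ι)
    (hν : ∀ᶠ i in (U : Filter ι), ν i ≤ C • P) :
    ∃ μ : Measure α, μ ≤ C • P ∧
      ∀ A, MeasurableSet A → Tendsto (fun i => ν i A) U (𝓝 (μ A)) := by
  set L : Set α → ℝ≥0∞ := fun A => (U.map fun i => ν i A).lim with hL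
  have hlim : ∀ A, Tendsto (fun i => ν i A) U (𝓝 (L A)) := fun A =>
    (U.map fun i => ν i A).le_nhds_lim
  have hle : ∀ A, L A ≤ (C • P) A := fun A =>
    le_of_tendsto (hlim A) (hν.mono fun i hi => hi A)
  have h0 : L ∅ = 0 := by
    have := hle ∅
    simpa using this
  have hU : ∀ ⦃f : ℕ → Set α⦄, (∀ i, MeasurableSet (f i)) → Pairwise (Function.onFun Disjoint f) →
      L (⋃ i, f i) = ∑' i, L (f i) := by
    intro f hf hd
    have hd' : ∀ N, Pairwise (Function.onFun Disjoint fun i => f (i + N)) := fun N i j hij =>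
      hd (by simpa using hij)
    have hsplit : ∀ N, L (⋃ i, f i) = ∑ i ∈ Finset.range N, L (f i) + L (⋃ i, f (i + N)) := by
      intro N
      refine tendsto_nhds_unique (hlim _) ?_
      refine ((tendsto_finsetSum _ fun i _ => hlim (f i)).add (hlim _)).congr fun i => ?_
      rw [measure_iUnion hd hf, measure_iUnion (hd' N) (fun i => hf _)]
      exact ENNReal.summable.sum_add_tsum_nat_add'
    -- domination by a finite measure gives continuity at `∅`, hence countable additivity
    have htail : Tendsto (fun N => L (⋃ i, f (i + N))) atTop (𝓝 0) := by
      refine tendsto_of_tendsto_of_tendsto_of_le_of_le tendsto_const_nhds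
        (h := fun N => ∑' i, (C • P) (f (i + N))) ?_ (fun _ => zero_le) fun N => ?_
      · refine ENNReal.tendsto_sum_nat_add (fun i => (C • P) (f i)) ?_
        rw [← measure_iUnion hd hf]
        exact measure_ne_top _ _
      · refine (hle _).trans ?_
        rw [measure_iUnion (hd' N) (fun i => hf _)]
    have h1 : Tendsto (fun N => ∑ i ∈ Finset.range N, L (f i) + L (⋃ i, f (i + N))) atTop
        (𝓝 (∑' i, L (f i) + 0)) := ENNReal.summable.hasSum.tendsto_sum_nat.add htail
    rw [add_zero] at h1
    refine tendsto_nhds_unique ?_ h1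
    simp only [← hsplit]
    exact tendsto_const_nhds
  have happ : ∀ A, MeasurableSet A →
      Measure.ofMeasurable (fun s _ => L s) h0 (fun f hf hd => hU hf hd) A = L A := fun A hA =>
    Measure.ofMeasurable_apply A hA
  refine ⟨Measure.ofMeasurable (fun s _ => L s) h0 (fun f hf hd => hU hf hd), ?_, ?_⟩
  · rw [Measure.le_iff]
    intro A hA
    rw [happ A hA]
    exact hle A
  · intro A hA
    rw [happ A hA]
    exact hlim A

end domination

/-! ### Birkhoff's ergodic theorem -/

section birkhoff

variable {α : Type*} {T : α → α} {f : α → ℝ}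

/-- The maximum of the Birkhoff sums `S₁, …, S_{n+1}`. -/
def maxSum (T : α → α) (f : α → ℝ) : ℕ → α → ℝ
  | 0, x => f x
  | n + 1, x => f x + max 0 (maxSum T f n (T x))

theorem maxSum_le_succ (n : ℕ) (x : α) : maxSum T f n x ≤ maxSum T f (n + 1) x := by
  induction n generalizing x with
  | zero => simp [maxSum]
  | succ n ih =>
    rw [maxSum, maxSum]
    gcongr
    exact ih _

theorem birkhoffSum_le_maxSum (n : ℕ) (x : α) :
    birkhoffSum T f (n + 1) x ≤ maxSum T f n x := by
  induction n generalizing x with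
  | zero => simp [maxSum]
  | succ n ih =>
    rw [birkhoffSum_succ', maxSum]
    gcongr
    exact (ih _).trans (le_max_right _ _)

variable [MeasurableSpace α] {μ : Measure α}

theorem measurable_maxSum (hT : Measurable T) (hf : Measurable f) (n : ℕ) :
    Measurable (maxSum T f n) := by
  induction n with
  | zero => exact hf
  | succ n ih => exact hf.add (measurable_const.max (ih.comp hT))

theorem integrable_maxSum (hT : MeasurePreserving T μ μ) (hfi : Integrable f μ) (n : ℕ) :
    Integrable (maxSum T f n) μ := by
  induction n with
  | zero => exact hfi
  | succ n ih =>
    refine hfi.add ?_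
    have h := (hT.integrable_comp ih.aestronglyMeasurable).mpr ih
    refine h.norm.mono' ?_ (ae_of_all _ fun x => ?_)
    · exact (aestronglyMeasurable_const.sup h.aestronglyMeasurable)
    · simp only [Function.comp, Real.norm_eq_abs]
      rw [abs_of_nonneg (le_max_left _ _)]
      exact max_le (abs_nonneg _) (le_abs_self _)

/-- The maximal ergodic inequality on the set where the Birkhoff sums are unbounded above. -/
theorem setIntegral_nonneg_of_unbounded (hT : MeasurePreserving T μ μ) (hf : Measurable f)
    (hfi : Integrable f μ) {A : Set α} (hA : MeasurableSet A) (hinv : T ⁻¹' A = A)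
    (hub : ∀ x ∈ A, ¬ BddAbove (Set.range fun n => birkhoffSum T f n x)) :
    0 ≤ ∫ x in A, f x ∂μ := by
  have hmono : ∀ x, Monotone fun n => maxSum T f n x := fun x =>
    monotone_nat_of_le_succ fun n => maxSum_le_succ n x
  have hTA : ∀ x ∈ A, T x ∈ A := fun x hx => by rwa [← hinv] at hx
  have htop : ∀ x ∈ A, Tendsto (fun n => maxSum T f n x) atTop atTop := by
    intro x hx
    refine tendsto_atTop_atTop_of_monotone (hmono x) fun b => ?_
    by_contra! hcon
    refine hub x hx ⟨max 0 b, ?_⟩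
    rintro _ ⟨n, rfl⟩
    cases n with
    | zero => simp
    | succ n =>
      exact (birkhoffSum_le_maxSum n x).trans ((hcon n).le.trans (le_max_right _ _))
  -- this difference decreases to `f` on `A`, where the maxima tend to infinity
  have hD : ∀ n x, maxSum T f (n + 1) x - maxSum T f n (T x)
      = f x + max (-maxSum T f n (T x)) 0 := by
    intro n x
    rw [maxSum, add_sub_assoc, ← max_sub_sub_right, zero_sub, sub_self]
  have hlim : Tendsto (fun n => ∫ x in A, (maxSum T f (n + 1) x - maxSum T f n (T x)) ∂μ) atTop
      (𝓝 (∫ x in A, f x ∂μ)) := by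
    have hfT : Integrable (f ∘ T) μ := (hT.integrable_comp hfi.aestronglyMeasurable).mpr hfi
    refine tendsto_integral_of_dominated_convergence (fun x => |f x| + |f (T x)|) ?_ ?_ ?_ ?_
    · exact fun n => ((measurable_maxSum hT.measurable hf (n + 1)).sub
        ((measurable_maxSum hT.measurable hf n).comp hT.measurable)).aestronglyMeasurable
    · exact (hfi.abs.add hfT.abs).integrableOn
    · refine fun n => ae_of_all _ fun x => ?_
      rw [hD, Real.norm_eq_abs]
      refine (abs_add_le _ _).trans (add_le_add le_rfl ?_)
      rw [abs_of_nonneg (le_max_right _ _)]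
      refine max_le ?_ (abs_nonneg _)
      have : f (T x) ≤ maxSum T f n (T x) := hmono (T x) (Nat.zero_le n)
      exact (neg_le_neg this).trans (neg_le_abs _)
    · refine (ae_restrict_iff' hA).mpr (ae_of_all _ fun x hx => ?_)
      refine tendsto_const_nhds.congr' ?_
      filter_upwards [(htop (T x) (hTA x hx)).eventually_ge_atTop 0] with n hn
      rw [hD, max_eq_right (by linarith), add_zero]
  -- by invariance of `A` its integral over `A` is that of `maxSum (n + 1) - maxSum n`
  refine ge_of_tendsto' hlim fun n => ?_
  have hi := integrable_maxSum hT hfi n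
  have hi' := integrable_maxSum hT hfi (n + 1)
  have hiT : Integrable (fun x => maxSum T f n (T x)) μ :=
    (hT.integrable_comp hi.aestronglyMeasurable).mpr hi
  rw [integral_sub hi'.integrableOn hiT.integrableOn]
  have heq : ∫ x in A, maxSum T f n (T x) ∂μ = ∫ x in A, maxSum T f n x ∂μ := by
    rw [← integral_indicator hA, ← integral_indicator hA]
    have h1 : A.indicator (fun x => maxSum T f n (T x))
        = fun x => A.indicator (maxSum T f n) (T x) := by
      funext x
      have : x ∈ A ↔ T x ∈ A := by
        conv_lhs => rw [← hinv]
        rfl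
      by_cases hx : x ∈ A
      · rw [Set.indicator_of_mem hx, Set.indicator_of_mem (this.mp hx)]
      · rw [Set.indicator_of_notMem hx, Set.indicator_of_notMem (fun h => hx (this.mpr h))]
    rw [h1]
    have h2 := integral_map (μ := μ) (φ := T) hT.measurable.aemeasurable
      (f := A.indicator (maxSum T f n))
      ((measurable_maxSum hT.measurable hf n).indicator hA).aestronglyMeasurable
    rw [hT.map_eq] at h2
    exact h2.symm
  rw [heq, sub_nonneg]
  exact setIntegral_mono hi.integrableOn hi'.integrableOn fun x => maxSum_le_succ n x

/-- The Birkhoff sums of a function with negative mean are bounded above. -/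
theorem ae_bddAbove_birkhoffSum [IsProbabilityMeasure μ] (hT : Ergodic T μ) (hf : Measurable f)
    (hfi : Integrable f μ) (hneg : ∫ x, f x ∂μ < 0) :
    ∀ᵐ x ∂μ, BddAbove (Set.range fun n => birkhoffSum T f n x) := by
  set A : Set α := {x | ¬ BddAbove (Set.range fun n => birkhoffSum T f n x)} with hAdef
  have hm : ∀ n, Measurable fun x => birkhoffSum T f n x := fun n =>
    Finset.measurable_sum _ fun k _ => hf.comp (hT.measurable.iterate k)
  have hA : MeasurableSet A := (measurableSet_bddAbove_range hm).compl
  have hinv : T ⁻¹' A = A := by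
    ext x
    simp only [hAdef, Set.mem_preimage, Set.mem_ofPred_eq, not_iff_not]
    constructor
    · rintro ⟨b, hb⟩
      refine ⟨max 0 (f x + b), ?_⟩
      rintro _ ⟨n, rfl⟩
      cases n with
      | zero => simp
      | succ n =>
        simp only [birkhoffSum_succ']
        exact le_max_of_le_right (by gcongr; exact hb ⟨n, rfl⟩)
    · rintro ⟨b, hb⟩
      refine ⟨b - f x, ?_⟩
      rintro _ ⟨n, rfl⟩
      have h := hb ⟨n + 1, rfl⟩
      simp only [birkhoffSum_succ'] at h
      simp only
      linarith
  have hnn := setIntegral_nonneg_of_unbounded hT.toMeasurePreserving hf hfi hA hinv fun x hx => hx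
  rcases hT.toPreErgodic.prob_eq_zero_or_one hA hinv with h | h
  · rw [ae_iff]
    exact h
  · have : ∫ x in A, f x ∂μ = ∫ x, f x ∂μ := by
      rw [Measure.restrict_eq_self_of_ae_mem]
      exact (mem_ae_iff_prob_eq_one hA).mpr h
    linarith

theorem ae_eventually_birkhoffSum_le [IsProbabilityMeasure μ] (hT : Ergodic T μ)
    (hf : Measurable f) (hfi : Integrable f μ) :
    ∀ᵐ x ∂μ, ∀ c > ∫ x, f x ∂μ, ∀ᶠ n : ℕ in atTop, birkhoffSum T f n x / n < c := by
  have h : ∀ j : ℕ, ∀ᵐ x ∂μ, BddAbove (Set.range fun n =>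
      birkhoffSum T (fun x => f x - (∫ x, f x ∂μ + 1 / (j + 1))) n x) := by
    intro j
    refine ae_bddAbove_birkhoffSum hT (hf.sub_const _) (hfi.sub (integrable_const _)) ?_
    rw [integral_sub hfi (integrable_const _), integral_const]
    simp only [probReal_univ, smul_eq_mul, one_mul]
    have : (0 : ℝ) < 1 / (j + 1) := by positivity
    linarith
  filter_upwards [ae_all_iff.mpr h] with x hx c hc
  obtain ⟨j, hj⟩ := exists_nat_one_div_lt (sub_pos.mpr hc)
  obtain ⟨b, hb⟩ := hx j
  set e := ∫ x, f x ∂μ + 1 / ((j : ℝ) + 1) with he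
  have hec : e < c := by linarith
  have hlim : Tendsto (fun n : ℕ => b / n) atTop (𝓝 0) := tendsto_const_div_atTop_nhds_zero_nat b
  filter_upwards [hlim.eventually_lt_const (sub_pos.mpr hec), eventually_gt_atTop 0] with n hn hn0
  have h1 := hb ⟨n, rfl⟩
  simp only [birkhoffSum, Finset.sum_sub_distrib, Finset.sum_const, Finset.card_range,
    nsmul_eq_mul] at h1
  have hn' : (0 : ℝ) < n := by exact_mod_cast hn0
  have h2 : birkhoffSum T f n x ≤ b + n * e := by
    rw [birkhoffSum]
    linarith
  calc birkhoffSum T f n x / n ≤ (b + n * e) / n := by gcongr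
    _ = b / n + e := by field_simp
    _ < c := by linarith

/-- Birkhoff's pointwise ergodic theorem for an ergodic transformation. -/
theorem tendsto_birkhoffSum_div [IsProbabilityMeasure μ] (hT : Ergodic T μ)
    (hf : Measurable f) (hfi : Integrable f μ) :
    ∀ᵐ x ∂μ, Tendsto (fun n : ℕ => birkhoffSum T f n x / n) atTop (𝓝 (∫ x, f x ∂μ)) := by
  filter_upwards [ae_eventually_birkhoffSum_le hT hf hfi,
    ae_eventually_birkhoffSum_le hT hf.neg hfi.neg] with x h1 h2
  refine tendsto_order.mpr ⟨fun c hc => ?_, fun c hc => h1 c hc⟩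
  have h3 := h2 (-c) (by
    simp only [Pi.neg_apply, integral_neg]
    linarith)
  refine h3.mono fun n hn => ?_
  have h4 : birkhoffSum T (-f) n x = -birkhoffSum T f n x := by
    simp [birkhoffSum]
  rw [h4, neg_div] at hn
  linarith

end birkhoff

/-! ### Ergodic invariant measures of Markov kernels -/

section kernel

variable {α : Type*} [MeasurableSpace α] {K : Kernel α α} [IsMarkovKernel K]

/-- For an invariant measure the flow out of a set equals the flow into it. -/
theorem setLIntegral_compl_flow {μ : Measure α} [IsFiniteMeasure μ] (hμ : Kernel.Invariant K μ)
    {A : Set α} (hA : MeasurableSet A) :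
    ∫⁻ x in A, K x Aᶜ ∂μ = ∫⁻ x in Aᶜ, K x A ∂μ := by
  have h1 : μ A = ∫⁻ x in A, K x A ∂μ + ∫⁻ x in Aᶜ, K x A ∂μ := by
    rw [lintegral_add_compl _ hA]
    conv_lhs => rw [← hμ.def, Measure.bind_apply hA K.aemeasurable]
  have h2 : μ A = ∫⁻ x in A, K x A ∂μ + ∫⁻ x in A, K x Aᶜ ∂μ := by
    rw [← lintegral_add_left (K.measurable_coe hA)]
    simp [prob_add_prob_compl hA]
  have h3 : ∫⁻ x in A, K x A ∂μ ≠ ∞ :=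
    ne_top_of_le_ne_top (measure_ne_top μ A) (by rw [h1]; exact le_self_add)
  exact (ENNReal.add_right_inj h3).mp (h2.symm.trans h1)

/-- An ergodic invariant probability measure is the only invariant probability measure that is
absolutely continuous with respect to it. -/
theorem IsErgodicInvariant.eq_of_absolutelyContinuous {μ ν : Measure α} [IsProbabilityMeasure μ]
    [IsProbabilityMeasure ν] (hμ : IsErgodicInvariant K μ) (hν : Kernel.Invariant K ν)
    (hac : ν ≪ μ) : ν = μ := by
  set h := ν.rnDeriv μ with hh
  have hmeas : Measurable h := Measure.measurable_rnDeriv ν μ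
  have hdens : μ.withDensity h = ν := Measure.withDensity_rnDeriv_eq ν μ hac
  set A : Set α := {x | 1 < h x} with hAdef
  have hA : MeasurableSet A := measurableSet_lt measurable_const hmeas
  have hsplit : ∀ {s : Set α}, MeasurableSet s → ∀ {w : α → ℝ≥0∞}, Measurable w →
      ∫⁻ x in s, w x ∂ν = ∫⁻ x in s, h x * w x ∂μ := by
    intro s hs w hw
    rw [← hdens, setLIntegral_withDensity_eq_setLIntegral_mul _ hmeas hw hs]
    rfl
  have hwm : Measurable fun x => K x Aᶜ := K.measurable_coe hA.compl
  -- for `ν` the flow out of `A` is larger than for `μ` and the flow into `A` is smaller, so that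
  -- the balance of flows forces both to vanish
  have hle : ∫⁻ x in A, h x * K x Aᶜ ∂μ ≤ ∫⁻ x in A, K x Aᶜ ∂μ := by
    rw [← hsplit hA hwm, setLIntegral_compl_flow hν hA, setLIntegral_compl_flow hμ.1 hA,
      hsplit hA.compl (K.measurable_coe hA)]
    refine setLIntegral_mono (K.measurable_coe hA) fun x hx => ?_
    exact mul_le_of_le_one_left' (not_lt.mp hx)
  have hfin : ∫⁻ x in A, K x Aᶜ ∂μ ≠ ∞ := by
    refine ne_top_of_le_ne_top (measure_ne_top μ A) ?_
    calc ∫⁻ x in A, K x Aᶜ ∂μ ≤ ∫⁻ x in A, 1 ∂μ := lintegral_mono fun x => prob_le_one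
      _ = μ A := by simp
  have hout : ∀ᵐ x ∂(μ.restrict A), K x Aᶜ = 0 := by
    have h1 : (fun x => K x Aᶜ) ≤ᵐ[μ.restrict A] fun x => h x * K x Aᶜ := by
      refine (ae_restrict_iff' hA).mpr (ae_of_all _ fun x hx => ?_)
      exact le_mul_of_one_le_left' (le_of_lt hx)
    have h2 := ae_eq_of_ae_le_of_lintegral_le h1 hfin (hmeas.mul hwm).aemeasurable hle
    filter_upwards [h2, ae_restrict_mem hA] with x hx hxA
    by_contra hne
    have h3 : 1 * K x Aᶜ < h x * K x Aᶜ :=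
      ENNReal.mul_lt_mul_left hne (measure_ne_top _ _) hxA
    rw [one_mul, ← hx] at h3
    exact lt_irrefl _ h3
  have hin : ∀ᵐ x ∂(μ.restrict Aᶜ), K x A = 0 := by
    have h1 : ∫⁻ x in Aᶜ, K x A ∂μ = 0 := by
      rw [← setLIntegral_compl_flow hμ.1 hA]
      exact (lintegral_eq_zero_iff hwm).mpr hout
    exact (lintegral_eq_zero_iff (K.measurable_coe hA)).mp h1
  have hinv : ∀ᵐ x ∂μ, K x A = A.indicator 1 x := by
    filter_upwards [(ae_restrict_iff' hA).mp hout, (ae_restrict_iff' hA.compl).mp hin] with x h1 h2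
    by_cases hx : x ∈ A
    · rw [Set.indicator_of_mem hx]
      exact (prob_compl_eq_zero_iff hA).mp (h1 hx)
    · rw [Set.indicator_of_notMem hx]
      exact h2 hx
  have hA0 : μ A = 0 := by
    rcases hμ.2 A hA hinv with h0 | h0
    · exact h0
    · exfalso
      have hall : ∀ᵐ x ∂μ, 1 < h x := by
        rw [ae_iff]
        exact h0
      have h1 : ∫⁻ x, h x ∂μ ≤ ∫⁻ _, 1 ∂μ := by
        rw [← setLIntegral_univ, ← withDensity_apply _ MeasurableSet.univ, hdens]
        simp
      have h2 := ae_eq_of_ae_le_of_lintegral_le (hall.mono fun x hx => hx.le) (by simp)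
        hmeas.aemeasurable h1
      obtain ⟨x, hx1, hx2⟩ := (hall.and h2).exists
      exact hx1.ne hx2
  have hνμ : ν ≤ μ := by
    rw [← hdens]
    conv_rhs => rw [← withDensity_one (μ := μ)]
    refine withDensity_mono ?_
    rw [EventuallyLE, ae_iff]
    simpa [hAdef] using hA0
  exact Measure.eq_of_le_of_measure_univ_eq hνμ (by simp)

end kernel

/-! ### The environment viewed from the particle -/

theorem truncate_coord_le (ϱ : ℕ∞) (ω : Env) (x : ℤ) {y : ℤ} (hy : y ≠ 0) :
    (truncate ϱ ω).1 x y ≤ ω.1 x y := by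
  change truncFun ϱ ω.1 x y ≤ _
  unfold truncFun
  rw [if_neg hy]
  split_ifs
  · exact le_rfl
  · exact zero_le

theorem truncate_coord_of_lt (ϱ : ℕ∞) (ω : Env) (x : ℤ) {y : ℤ} (hy : y ≠ 0)
    (h : (y.natAbs : ℕ∞) < ϱ) : (truncate ϱ ω).1 x y = ω.1 x y := by
  change truncFun ϱ ω.1 x y = _
  unfold truncFun
  rw [if_neg hy, if_pos h]

theorem truncate_coord_one {ϱ : ℕ∞} (hϱ : 1 < ϱ) (ω : Env) (x : ℤ) :
    (truncate ϱ ω).1 x 1 = ω.1 x 1 :=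
  truncate_coord_of_lt ϱ ω x one_ne_zero (by simpa using hϱ)

theorem envKernel_apply (ϱ : ℕ∞) (ω : Env) {A : Set Env} (hA : MeasurableSet A) :
    envKernel ϱ ω A
      = ∑' y : ℤ, ((truncate ϱ ω).1 0 y : ℝ≥0∞) * A.indicator 1 (shift y ω) := by
  change ((jumpPMF (truncate ϱ ω) 0).toMeasure.map fun y => shift y ω) A = _
  rw [Measure.map_apply (measurable_of_countable _) hA,
    PMF.toMeasure_apply _ (DiscreteMeasurableSpace.forall_measurableSet _)]
  refine tsum_congr fun y => ?_
  by_cases hy : shift y ω ∈ A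
  · rw [Set.indicator_of_mem (by exact hy), Set.indicator_of_mem hy, Pi.one_apply, mul_one]
    rfl
  · rw [Set.indicator_of_notMem (by exact hy), Set.indicator_of_notMem hy, mul_zero]

instance (ϱ : ℕ∞) : IsMarkovKernel (envKernel ϱ) := by
  refine ⟨fun ω => ⟨?_⟩⟩
  rw [envKernel_apply ϱ ω MeasurableSet.univ]
  simp [tsum_coord]

theorem measurePreserving_shift {P : Measure Env} (hP : MeasurePreserving (shift 1) P P) (z : ℤ) :
    MeasurePreserving (shift z) P P := by
  have hnat : ∀ n : ℕ, MeasurePreserving (shift n) P P := by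
    intro n
    induction n with
    | zero =>
      have : shift ((0 : ℕ) : ℤ) = id := by funext ω; exact shift_zero ω
      rw [this]
      exact MeasurePreserving.id P
    | succ n ih =>
      have : shift ((n + 1 : ℕ) : ℤ) = shift n ∘ shift 1 := by
        funext ω; simp [shift_shift]
      rw [this]
      exact ih.comp hP
  rcases Int.eq_nat_or_neg z with ⟨n, rfl | rfl⟩
  · exact hnat n
  · refine ⟨measurable_shift _, ?_⟩
    conv_lhs => rw [← (hnat n).map_eq]
    rw [Measure.map_map (measurable_shift _) (measurable_shift _)]
    have : shift (-(n : ℤ)) ∘ shift n = id := by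
      funext ω; simp [shift_shift, shift_zero]
    rw [this, Measure.map_id]

theorem ae_forall_shift {P : Measure Env} (hP : MeasurePreserving (shift 1) P P)
    {p : Env → Prop} (hp : ∀ᵐ ω ∂P, p ω) : ∀ᵐ ω ∂P, ∀ z, p (shift z ω) :=
  ae_all_iff.mpr fun z => (measurePreserving_shift hP z).quasiMeasurePreserving.ae hp

/-- By ellipticity an event that is invariant for the environment viewed from the particle is
invariant under the spatial shift, so that ergodicity is inherited from the environment. -/
theorem isErgodicInvariant_envKernel {P Q : Measure Env} (hP : Ergodic (shift 1) P) {ϱ : ℕ∞}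
    (hpos : ∀ᵐ ω ∂P, 0 < (truncate ϱ ω).1 0 1) (hQP : Q ≪ P) (hPQ : P ≪ Q)
    (hinv : Kernel.Invariant (envKernel ϱ) Q) : IsErgodicInvariant (envKernel ϱ) Q := by
  refine ⟨hinv, fun A hA h => ?_⟩
  have hshift : shift 1 ⁻¹' A =ᵐ[P] A := by
    rw [eventuallyEq_set]
    filter_upwards [hPQ.ae_le h, hpos] with ω h1 h2
    have hmem : ∀ {B : Set Env}, MeasurableSet B → envKernel ϱ ω B = 0 → shift 1 ω ∉ B := by
      intro B hB h0 hmem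
      rw [envKernel_apply ϱ ω hB, ENNReal.tsum_eq_zero] at h0
      have := h0 1
      rw [Set.indicator_of_mem hmem, Pi.one_apply, mul_one] at this
      exact h2.ne' (by exact_mod_cast this)
    by_cases hω : ω ∈ A
    · rw [Set.indicator_of_mem hω] at h1
      have := hmem hA.compl ((prob_compl_eq_zero_iff hA).mpr h1)
      simpa [hω] using this
    · rw [Set.indicator_of_notMem hω] at h1
      have := hmem hA h1
      simpa [hω] using this
  rcases hP.quasiErgodic.ae_empty_or_univ₀ hA.nullMeasurableSet hshift with h0 | h0
  · exact Or.inl (hQP (ae_eq_empty.mp h0))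
  · exact Or.inr (hQP (ae_eq_univ.mp h0))

/-! ### Construction of the invariant measure -/

/-- At every site a jump has length at least `s` with probability at most `t s`, for all `s ≥ 1`. -/
def TailBound (η : Env) (t : ℕ → ℝ≥0∞) : Prop :=
  ∀ x, ∀ s : ℕ, 1 ≤ s → ∑' y : ℤ, (if s ≤ y.natAbs then (η.1 x y : ℝ≥0∞) else 0) ≤ t s

/-- The quenched form, at all sites of an environment, of ellipticity, of the tail condition, and of
the bound on the expected number of visits to sites to the left of the starting point. -/
structure Controlled (η : Env) (ε : ℝ≥0∞) (t g : ℕ → ℝ≥0∞) : Prop where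
  le_one : ∀ x, ε ≤ η.1 x 1
  tail_le : TailBound η t
  green_le : ∀ x y, y ≤ x → green η x y ≤ g (x - y).natAbs

theorem natCast_eq_tsum (n : ℕ) : (n : ℝ≥0∞) = ∑' s : ℕ, if s + 1 ≤ n then 1 else 0 := by
  rw [tsum_eq_sum (s := Finset.range n)]
  · rw [Finset.sum_congr rfl fun s hs => if_pos (Nat.succ_le_of_lt (Finset.mem_range.mp hs))]
    simp
  · intro s hs
    rw [if_neg]
    simpa using hs

/-- The first absolute moment of a jump is bounded by the sum of the tail bounds. -/
theorem tsum_natAbs_mul_le {η : Env} {t : ℕ → ℝ≥0∞} {x : ℤ}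
    (ht : ∀ s : ℕ, 1 ≤ s → ∑' y : ℤ, (if s ≤ y.natAbs then (η.1 x y : ℝ≥0∞) else 0) ≤ t s) :
    ∑' y : ℤ, (y.natAbs : ℝ≥0∞) * η.1 x y ≤ ∑' s, t (s + 1) := by
  have h : ∀ y : ℤ, (y.natAbs : ℝ≥0∞) * η.1 x y
      = ∑' s : ℕ, if s + 1 ≤ y.natAbs then (η.1 x y : ℝ≥0∞) else 0 := by
    intro y
    rw [natCast_eq_tsum, ← ENNReal.tsum_mul_right]
    refine tsum_congr fun s => ?_
    split_ifs <;> simp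
  simp only [h]
  rw [ENNReal.tsum_comm]
  exact ENNReal.tsum_le_tsum fun s => ht (s + 1) (by omega)

/-- Translating a window of length `n` by `y` changes at most `|y|` summands. -/
theorem sum_translate_le (a : ℤ → ℝ≥0∞) {G : ℝ≥0∞} (ha : ∀ i, a i ≤ G) (n : ℕ) (y : ℤ) :
    ∑ k ∈ Finset.range n, a (k + y) ≤ ∑ k ∈ Finset.range n, a k + y.natAbs * G := by
  have h1 : ∀ z : ℤ, ∑ k ∈ Finset.range n, a (k + z) = ∑ i ∈ Finset.Ico z (n + z), a i := by
    intro z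
    refine Finset.sum_nbij (fun k : ℕ => (k : ℤ) + z) ?_ ?_ ?_ ?_
    · intro k hk
      have := Finset.mem_range.mp hk
      simp only [Finset.mem_Ico]
      omega
    · intro k _ l _ h
      simpa using h
    · intro i hi
      have := Finset.mem_Ico.mp (Finset.mem_coe.mp hi)
      exact ⟨(i - z).toNat, by simp only [Finset.coe_range, Set.mem_Iio]; omega,
        by simp only; omega⟩
    · intro k _
      rfl
  have h2 := h1 0
  simp only [add_zero] at h2
  rw [h1 y, h2, ← Finset.sum_inter_add_sum_sdiff _ (Finset.Ico (0 : ℤ) n)]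
  refine add_le_add (Finset.sum_le_sum_of_subset Finset.inter_subset_right) ?_
  refine (Finset.sum_le_card_nsmul _ _ G fun i _ => ha i).trans ?_
  rw [nsmul_eq_mul]
  gcongr
  have hsub : Finset.Ico y (n + y) \ Finset.Ico 0 (n : ℤ)
      ⊆ Finset.Ico (n : ℤ) (n + y) ∪ Finset.Ico y 0 := by
    intro i hi
    simp only [Finset.mem_sdiff, Finset.mem_Ico, Finset.mem_union] at hi ⊢
    omega
  refine (Finset.card_le_card hsub).trans ((Finset.card_union_le _ _).trans ?_)
  simp only [Int.card_Ico]
  omega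

section construction

variable {P : Measure Env} {ϱ : ℕ∞} {ε : ℝ≥0∞} {t g : ℕ → ℝ≥0∞}

/-- The expected number of visits to `0`, summed over the `n` starting points `-1, …, -n`.  Divided
by `n` it is an approximately invariant density. -/
noncomputable def greenSum (ϱ : ℕ∞) (n : ℕ) (ω : Env) : ℝ≥0∞ :=
  ∑ k ∈ Finset.range n, green (truncate ϱ ω) (-((k : ℤ) + 1)) 0

theorem measurable_greenSum (n : ℕ) : Measurable (greenSum ϱ n) :=
  Finset.measurable_sum _ fun _ _ => (measurable_green _ _).comp (measurable_truncate ϱ)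

theorem greenSum_le {ω : Env} (h : Controlled (truncate ϱ ω) ε t g) (n : ℕ) :
    greenSum ϱ n ω ≤ n * g 0 :=
  (Finset.sum_le_sum fun _ _ => green_le_zero_apply h.green_le _ _).trans (by simp)

theorem le_greenSum {ω : Env} (h : Controlled (truncate ϱ ω) ε t g) (hg : ∑' m, g m ≠ ∞)
    (hε1 : ε ≤ 1) {M : ℕ} (hM : g 0 * ∑' m, t (m + M + 1) ≤ 2⁻¹) (n : ℕ) :
    n * (ε ^ M * 2⁻¹ / M) ≤ greenSum ϱ n ω := by
  have h1 : ∀ k : ℕ, ε ^ M * 2⁻¹ / M ≤ green (truncate ϱ ω) (-((k : ℤ) + 1)) 0 := by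
    intro k
    refine ENNReal.div_le_of_le_mul' ?_
    have := le_mul_green h.green_le hg h.tail_le hε1 h.le_one hM (k + 1)
    simpa using this
  calc (n : ℝ≥0∞) * (ε ^ M * 2⁻¹ / M) = ∑ _k ∈ Finset.range n, ε ^ M * 2⁻¹ / M := by simp
    _ ≤ _ := Finset.sum_le_sum fun k _ => h1 k

/-- The density `greenSum ϱ n` is invariant up to a boundary term that does not depend on `n`. -/
theorem lintegral_envKernel_mul_greenSum_le [IsProbabilityMeasure P]
    (hP : MeasurePreserving (shift 1) P P)
    (hc : ∀ᵐ ω ∂P, Controlled (truncate ϱ ω) ε t g) (n : ℕ) {A : Set Env}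
    (hA : MeasurableSet A) :
    ∫⁻ ω, envKernel ϱ ω A * greenSum ϱ n ω ∂P
      ≤ ∫⁻ ω in A, greenSum ϱ n ω ∂P + g 0 * ∑' s, t (s + 1) := by
  have hcoord : ∀ x y : ℤ, Measurable fun ω : Env => ((truncate ϱ ω).1 x y : ℝ≥0∞) := fun x y =>
    (measurable_truncate_coord ϱ x y).coe_nnreal_ennreal
  have hind : Measurable fun ω : Env => A.indicator (1 : Env → ℝ≥0∞) ω :=
    measurable_one.indicator hA
  -- each summand is moved to the environment after the jump by stationarity
  have hterm : ∀ y : ℤ, ∫⁻ ω, ((truncate ϱ ω).1 0 y : ℝ≥0∞) * A.indicator 1 (shift y ω)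
        * greenSum ϱ n ω ∂P
      = ∫⁻ ω, A.indicator 1 ω * (((truncate ϱ ω).1 (-y) y : ℝ≥0∞)
        * ∑ k ∈ Finset.range n, green (truncate ϱ ω) (-((k : ℤ) + 1) + -y) (-y)) ∂P := by
    intro y
    have hm : Measurable fun ω : Env => A.indicator 1 ω * (((truncate ϱ ω).1 (-y) y : ℝ≥0∞)
        * ∑ k ∈ Finset.range n, green (truncate ϱ ω) (-((k : ℤ) + 1) + -y) (-y)) :=
      hind.mul ((hcoord _ _).mul (Finset.measurable_sum _ fun _ _ =>
        (measurable_green _ _).comp (measurable_truncate ϱ)))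
    rw [← (measurePreserving_shift hP y).lintegral_comp hm]
    refine lintegral_congr fun ω => ?_
    simp only [truncate_shift, shift_coord, green_shift, neg_add_cancel, neg_add_cancel_right,
      greenSum]
    ring
  have hpt : ∀ᵐ ω ∂P, ∑' y : ℤ, A.indicator 1 ω * (((truncate ϱ ω).1 (-y) y : ℝ≥0∞)
        * ∑ k ∈ Finset.range n, green (truncate ϱ ω) (-((k : ℤ) + 1) + -y) (-y))
      ≤ A.indicator (greenSum ϱ n) ω
        + g 0 * ∑' y : ℤ, (y.natAbs : ℝ≥0∞) * (truncate ϱ ω).1 (-y) y := by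
    filter_upwards [hc] with ω hω
    by_cases hωA : ω ∈ A
    · simp only [Set.indicator_of_mem hωA, Pi.one_apply, one_mul]
      have h1 : ∀ y : ℤ,
          ∑ k ∈ Finset.range n, green (truncate ϱ ω) (-((k : ℤ) + 1) + -y) (-y)
          ≤ ∑ k ∈ Finset.range n, green (truncate ϱ ω) (-((k : ℤ) + 1)) (-y)
            + y.natAbs * g 0 := by
        intro y
        have h := sum_translate_le (fun i => green (truncate ϱ ω) (-(i + 1)) (-y))
          (fun i => green_le_zero_apply hω.green_le _ _) n y
        refine le_trans (le_of_eq (Finset.sum_congr rfl fun k _ => ?_)) h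
        congr 1
        ring
      calc ∑' y : ℤ, ((truncate ϱ ω).1 (-y) y : ℝ≥0∞)
            * ∑ k ∈ Finset.range n, green (truncate ϱ ω) (-((k : ℤ) + 1) + -y) (-y)
          ≤ ∑' y : ℤ, ((truncate ϱ ω).1 (-y) y : ℝ≥0∞)
            * (∑ k ∈ Finset.range n, green (truncate ϱ ω) (-((k : ℤ) + 1)) (-y)
              + y.natAbs * g 0) :=
            ENNReal.tsum_le_tsum fun y => mul_le_mul_right (h1 y) _
        _ = ∑' y : ℤ, ∑ k ∈ Finset.range n,
              green (truncate ϱ ω) (-((k : ℤ) + 1)) (-y) * ((truncate ϱ ω).1 (-y) y : ℝ≥0∞)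
            + g 0 * ∑' y : ℤ, (y.natAbs : ℝ≥0∞) * (truncate ϱ ω).1 (-y) y := by
            rw [← ENNReal.tsum_mul_left, ← ENNReal.tsum_add]
            refine tsum_congr fun y => ?_
            rw [mul_add, mul_comm, Finset.sum_mul]
            ring
        _ ≤ _ := by
            gcongr
            rw [Summable.tsum_finsetSum fun _ _ => ENNReal.summable, greenSum]
            refine Finset.sum_le_sum fun k _ => ?_
            conv_rhs => rw [green_last_step]
            refine le_trans (le_of_eq ?_) le_add_self
            rw [← (Equiv.neg ℤ).tsum_eq]
            refine tsum_congr fun y => ?_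
            simp
    · simp [Set.indicator_of_notMem hωA]
  have hD : ∫⁻ ω, ∑' y : ℤ, (y.natAbs : ℝ≥0∞) * (truncate ϱ ω).1 (-y) y ∂P
      ≤ ∑' s, t (s + 1) := by
    have h1 : ∀ y : ℤ, ∫⁻ ω, (y.natAbs : ℝ≥0∞) * (truncate ϱ ω).1 (-y) y ∂P
        = ∫⁻ ω, (y.natAbs : ℝ≥0∞) * (truncate ϱ ω).1 0 y ∂P := by
      intro y
      rw [← (measurePreserving_shift hP y).lintegral_comp ((hcoord (-y) y).const_mul _)]
      simp only [truncate_shift, shift_coord, neg_add_cancel]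
    rw [lintegral_tsum fun y => ((hcoord (-y) y).const_mul _).aemeasurable]
    simp only [h1]
    rw [← lintegral_tsum fun y => ((hcoord 0 y).const_mul _).aemeasurable]
    calc _ ≤ ∫⁻ _, ∑' s, t (s + 1) ∂P := lintegral_mono_ae (by
            filter_upwards [hc] with ω hω
            exact tsum_natAbs_mul_le (hω.tail_le 0))
      _ = _ := by simp
  calc ∫⁻ ω, envKernel ϱ ω A * greenSum ϱ n ω ∂P
      = ∫⁻ ω, ∑' y : ℤ, ((truncate ϱ ω).1 0 y : ℝ≥0∞) * A.indicator 1 (shift y ω)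
        * greenSum ϱ n ω ∂P := by
        simp only [envKernel_apply ϱ _ hA, ENNReal.tsum_mul_right]
    _ = ∑' y : ℤ, ∫⁻ ω, ((truncate ϱ ω).1 0 y : ℝ≥0∞) * A.indicator 1 (shift y ω)
        * greenSum ϱ n ω ∂P := lintegral_tsum fun y =>
          (((hcoord 0 y).mul (hind.comp (measurable_shift y))).mul
            (measurable_greenSum n)).aemeasurable
    _ = ∫⁻ ω, ∑' y : ℤ, A.indicator 1 ω * (((truncate ϱ ω).1 (-y) y : ℝ≥0∞)
        * ∑ k ∈ Finset.range n, green (truncate ϱ ω) (-((k : ℤ) + 1) + -y) (-y)) ∂P := by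
        simp only [hterm]
        exact (lintegral_tsum fun y => (hind.mul ((hcoord _ _).mul (Finset.measurable_sum _
          fun _ _ => (measurable_green _ _).comp (measurable_truncate ϱ)))).aemeasurable).symm
    _ ≤ ∫⁻ ω, A.indicator (greenSum ϱ n) ω
        + g 0 * ∑' y : ℤ, (y.natAbs : ℝ≥0∞) * (truncate ϱ ω).1 (-y) y ∂P :=
        lintegral_mono_ae hpt
    _ ≤ _ := by
        rw [lintegral_add_left ((measurable_greenSum n).indicator hA), lintegral_indicator hA,
          lintegral_const_mul _ (Measurable.tsum fun y => (hcoord (-y) y).const_mul _)]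
        gcongr

/-- A subinvariant finite measure of a Markov kernel is invariant, as the total mass is preserved. -/
theorem invariant_of_lintegral_le {α : Type*} [MeasurableSpace α] {K : Kernel α α}
    [IsMarkovKernel K] {μ : Measure α} [IsFiniteMeasure μ]
    (h : ∀ A, MeasurableSet A → ∫⁻ x, K x A ∂μ ≤ μ A) : Kernel.Invariant K μ := by
  refine Measure.eq_of_le_of_measure_univ_eq ?_ ?_
  · rw [Measure.le_iff]
    intro A hA
    rw [Measure.bind_apply hA K.aemeasurable]
    exact h A hA
  · rw [Measure.bind_apply MeasurableSet.univ K.aemeasurable]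
    simp

theorem tendsto_lintegral_of_tendsto_measure {α ι : Type*} [MeasurableSpace α] {P : Measure α}
    [IsFiniteMeasure P] {C : ℝ≥0} {ν : ι → Measure α} {μ : Measure α} {l : Filter ι}
    (hν : ∀ᶠ i in l, ν i ≤ C • P) (hμ : μ ≤ C • P)
    (h : ∀ A, MeasurableSet A → Tendsto (fun i => ν i A) l (𝓝 (μ A)))
    {φ : α → ℝ≥0∞} (hφ : Measurable φ) (hφ1 : ∀ x, φ x ≤ 1) :
    Tendsto (fun i => ∫⁻ x, φ x ∂(ν i)) l (𝓝 (∫⁻ x, φ x ∂μ)) := by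
  have hlt : ∀ x, φ x < ∞ := fun x => (hφ1 x).trans_lt ENNReal.one_lt_top
  have hint : Integrable (fun x => (φ x).toReal) P := by
    refine Integrable.of_bound hφ.ennreal_toReal.aestronglyMeasurable 1 (ae_of_all _ fun x => ?_)
    rw [Real.norm_of_nonneg ENNReal.toReal_nonneg]
    exact ENNReal.toReal_le_of_le_ofReal zero_le_one (by simpa using hφ1 x)
  have h1 := tendsto_integral_of_tendsto_measure hν hμ h hint
  have h2 : ∀ {m : Measure α}, m ≤ C • P →
      ENNReal.ofReal (∫ x, (φ x).toReal ∂m) = ∫⁻ x, φ x ∂m := by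
    intro m hm
    rw [ofReal_integral_eq_lintegral_ofReal
      ((hint.smul_measure_nnreal (c := C)).mono_measure hm)
      (ae_of_all _ fun _ => ENNReal.toReal_nonneg)]
    exact lintegral_congr fun x => ENNReal.ofReal_toReal (hlt x).ne
  rw [← h2 hμ]
  refine ((ENNReal.continuous_ofReal.tendsto _).comp h1).congr' ?_
  filter_upwards [hν] with i hi
  exact h2 hi

/-- An invariant probability measure of the environment viewed from the particle, with explicit
bounds on its density. -/
theorem exists_invariant [IsProbabilityMeasure P] (hP : MeasurePreserving (shift 1) P P)
    (hc : ∀ᵐ ω ∂P, Controlled (truncate ϱ ω) ε t g) (hg : ∑' m, g m ≠ ∞)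
    (ht : ∑' s, t (s + 1) ≠ ∞) (hε1 : ε ≤ 1) {M : ℕ}
    (hM : g 0 * ∑' m, t (m + M + 1) ≤ 2⁻¹) {δ G : ℝ≥0} (hδ : 0 < δ)
    (hδ' : (δ : ℝ≥0∞) = ε ^ M * 2⁻¹ / M) (hG : (G : ℝ≥0∞) = g 0) :
    ∃ Q : Measure Env, IsProbabilityMeasure Q ∧ Kernel.Invariant (envKernel ϱ) Q ∧
      (δ / G) • P ≤ Q ∧ Q ≤ (G / δ) • P := by
  set ν : ℕ → Measure Env := fun n =>
    P.withDensity fun ω => ((n + 1 : ℕ) : ℝ≥0∞)⁻¹ * greenSum ϱ (n + 1) ω with hν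
  have hn0 : ∀ n : ℕ, ((n + 1 : ℕ) : ℝ≥0∞) ≠ 0 := fun n => by simp
  have hnt : ∀ n : ℕ, ((n + 1 : ℕ) : ℝ≥0∞) ≠ ∞ := fun n => ENNReal.natCast_ne_top _
  have hle : ∀ n, ν n ≤ G • P := by
    intro n
    have : (G • P : Measure Env) = P.withDensity fun _ => (G : ℝ≥0∞) := by
      rw [withDensity_const]; rfl
    rw [this]
    refine withDensity_mono ?_
    filter_upwards [hc] with ω hω
    rw [hG, ← ENNReal.div_eq_inv_mul]
    exact ENNReal.div_le_of_le_mul' (greenSum_le hω _)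
  have hge : ∀ n, δ • P ≤ ν n := by
    intro n
    have : (δ • P : Measure Env) = P.withDensity fun _ => (δ : ℝ≥0∞) := by
      rw [withDensity_const]; rfl
    rw [this]
    refine withDensity_mono ?_
    filter_upwards [hc] with ω hω
    rw [hδ', ← ENNReal.div_eq_inv_mul, ENNReal.le_div_iff_mul_le (Or.inl (hn0 n))
      (Or.inl (hnt n)), mul_comm]
    exact le_greenSum hω hg hε1 hM _
  -- the boundary term is divided by `n + 1`, so that the limit is subinvariant
  obtain ⟨μ, hμle, hμlim⟩ := exists_tendsto_measure_of_le (C := G) (P := P) ν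
    (Ultrafilter.of atTop) (Eventually.of_forall hle)
  have hμge : δ • P ≤ μ := by
    rw [Measure.le_iff]
    exact fun A hA => ge_of_tendsto' (hμlim A hA) fun n => hge n A
  have hμfin : IsFiniteMeasure μ := isFiniteMeasure_of_le _ hμle
  have hinv : Kernel.Invariant (envKernel ϱ) μ := by
    refine invariant_of_lintegral_le fun A hA => ?_
    have hK : Measurable fun ω => envKernel ϱ ω A := (envKernel ϱ).measurable_coe hA
    have h1 := tendsto_lintegral_of_tendsto_measure (Eventually.of_forall hle) hμle hμlim hK
      fun ω => prob_le_one
    have h2 : ∀ n, ∫⁻ ω, envKernel ϱ ω A ∂(ν n)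
        ≤ ν n A + ((n + 1 : ℕ) : ℝ≥0∞)⁻¹ * (g 0 * ∑' s, t (s + 1)) := by
      intro n
      have h3 : ν n = ((n + 1 : ℕ) : ℝ≥0∞)⁻¹ • P.withDensity (greenSum ϱ (n + 1)) :=
        withDensity_smul _ (measurable_greenSum _)
      rw [h3, lintegral_smul_measure,
        lintegral_withDensity_eq_lintegral_mul _ (measurable_greenSum _) hK, Measure.smul_apply,
        withDensity_apply _ hA, smul_eq_mul, smul_eq_mul, ← mul_add]
      gcongr
      refine le_trans (le_of_eq ?_) (lintegral_envKernel_mul_greenSum_le hP hc (n + 1) hA)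
      exact lintegral_congr fun ω => mul_comm _ _
    have h3 : Tendsto (fun n : ℕ => ((n + 1 : ℕ) : ℝ≥0∞)⁻¹ * (g 0 * ∑' s, t (s + 1))) atTop
        (𝓝 (0 * (g 0 * ∑' s, t (s + 1)))) := by
      refine ENNReal.Tendsto.mul_const ?_ (Or.inr ?_)
      · exact ENNReal.tendsto_inv_nat_nhds_zero.comp (tendsto_add_atTop_nat 1)
      · exact ENNReal.mul_ne_top (hG ▸ ENNReal.coe_ne_top) ht
    rw [zero_mul] at h3
    have h4 := (hμlim A hA).add (h3.mono_left (Ultrafilter.of_le atTop))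
    rw [add_zero] at h4
    exact le_of_tendsto_of_tendsto' h1 h4 h2
  have hmlow : (δ : ℝ≥0∞) ≤ μ Set.univ := by
    have := hμge Set.univ
    simpa using this
  have hmup : μ Set.univ ≤ G := by
    have := hμle Set.univ
    simpa using this
  have hm0 : μ Set.univ ≠ 0 := fun h => by
    rw [h] at hmlow
    exact hδ.ne' (by simpa using hmlow)
  have hmt : μ Set.univ ≠ ∞ := measure_ne_top _ _
  have hGpos : 0 < G := by
    have : (δ : ℝ≥0∞) ≤ G := hmlow.trans hmup
    exact hδ.trans_le (by exact_mod_cast this)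
  refine ⟨(μ Set.univ)⁻¹ • μ, ⟨?_⟩, ?_, ?_, ?_⟩
  · rw [Measure.smul_apply, smul_eq_mul, ENNReal.inv_mul_cancel hm0 hmt]
  · unfold Kernel.Invariant
    rw [Measure.bind_smul, hinv.def]
  · rw [Measure.le_iff]
    intro A _
    have h1 := hμge A
    simp only [Measure.smul_apply, smul_eq_mul, ENNReal.smul_def] at h1 ⊢
    rw [ENNReal.coe_div hGpos.ne', div_eq_mul_inv, mul_comm (δ : ℝ≥0∞), mul_assoc]
    gcongr
  · rw [Measure.le_iff]
    intro A _
    have h1 := hμle A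
    simp only [Measure.smul_apply, smul_eq_mul, ENNReal.smul_def] at h1 ⊢
    rw [ENNReal.coe_div hδ.ne', div_eq_mul_inv, mul_comm (G : ℝ≥0∞), mul_assoc]
    gcongr

end construction

/-! ### The law of large numbers -/

theorem lintegral_envKernel (ϱ : ℕ∞) (ω : Env) {f : Env → ℝ≥0∞} (hf : Measurable f) :
    ∫⁻ η, f η ∂(envKernel ϱ ω)
      = ∑' y : ℤ, ((truncate ϱ ω).1 0 y : ℝ≥0∞) * f (shift y ω) := by
  change ∫⁻ η, f η ∂((jumpPMF (truncate ϱ ω) 0).toMeasure.map fun y => shift y ω) = _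
  rw [lintegral_map hf (measurable_of_countable _), lintegral_countable']
  refine tsum_congr fun y => ?_
  rw [PMF.toMeasure_apply_singleton _ _ (measurableSet_singleton _), mul_comm]
  rfl

/-- The quenched laws of the walk as a Markov kernel from environments to trajectories. -/
noncomputable def walkKernel (ϱ : ℕ∞) : Kernel Env (ℕ → ℤ) := ⟨walkLaw ϱ, measurable_walkLaw ϱ⟩

theorem walkKernel_apply (ϱ : ℕ∞) (ω : Env) : walkKernel ϱ ω = walkLaw ϱ ω := rfl

instance (ϱ : ℕ∞) : IsMarkovKernel (walkKernel ϱ) :=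
  ⟨fun ω => by rw [walkKernel_apply]; infer_instance⟩

/-- One step of the walk, seen from the particle: the environment is moved to the new position
`S 1`, and the trajectory is restarted there. -/
def skewShift (p : Env × (ℕ → ℤ)) : Env × (ℕ → ℤ) :=
  (shift (p.2 1) p.1, fun n => p.2 (n + 1) - p.2 1)

theorem measurable_skewShift : Measurable skewShift := by
  have hc : ∀ n, Measurable fun p : Env × (ℕ → ℤ) => p.2 n := fun n =>
    (measurable_pi_apply n).comp measurable_snd
  refine Measurable.prodMk ?_ (measurable_pi_lambda _ fun n => (hc (n + 1)).sub (hc 1))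
  have h : Measurable fun q : Env × ℤ => shift q.2 q.1 :=
    measurable_from_prod_countable_left fun z => measurable_shift z
  exact h.comp (measurable_fst.prodMk (hc 1))

/-- `skewShift` undoes the prepending of a first step; this holds for trajectories that start at `0`
only, hence almost surely. -/
theorem walkLaw_consWalk_preimage (ϱ : ℕ∞) (ω : Env) (y : ℤ) (B : Set (Env × (ℕ → ℤ))) :
    consWalk y ⁻¹' {S | skewShift (ω, S) ∈ B}
      =ᵐ[walkLaw ϱ (shift y ω)] {S | (shift y ω, S) ∈ B} := by
  rw [eventuallyEq_set]
  filter_upwards [ae_quenchedLaw_zero (truncate ϱ (shift y ω))] with S hS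
  have h : skewShift (ω, consWalk y S) = (shift y ω, S) := by
    simp only [skewShift, consWalk, hS, add_zero]
    congr 1
    funext n
    ring
  simp only [Set.mem_preimage, Set.mem_ofPred_eq, h]

theorem measurableSet_section {B : Set (Env × (ℕ → ℤ))} (hB : MeasurableSet B) (ω : Env) :
    MeasurableSet {S | (ω, S) ∈ B} := measurable_prodMk_left hB

theorem measurable_walkLaw_section (ϱ : ℕ∞) {B : Set (Env × (ℕ → ℤ))} (hB : MeasurableSet B) :
    Measurable fun ω => walkLaw ϱ ω {S | (ω, S) ∈ B} :=
  Kernel.measurable_kernel_prodMk_left (κ := walkKernel ϱ) hB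

/-- The Markov property in terms of `skewShift` and the chain of environments. -/
theorem walkLaw_skewShift_preimage (ϱ : ℕ∞) {B : Set (Env × (ℕ → ℤ))} (hB : MeasurableSet B)
    (ω : Env) : walkLaw ϱ ω {S | skewShift (ω, S) ∈ B}
      = ∫⁻ η, walkLaw ϱ η {S | (η, S) ∈ B} ∂(envKernel ϱ ω) := by
  have hm : MeasurableSet {S | skewShift (ω, S) ∈ B} :=
    measurableSet_section (measurable_skewShift hB) ω
  rw [lintegral_envKernel ϱ ω (measurable_walkLaw_section ϱ hB), walkLaw,
    quenchedLaw_apply_first_step _ hm]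
  refine tsum_congr fun y => ?_
  congr 1
  exact measure_congr (walkLaw_consWalk_preimage ϱ ω y B)

theorem lintegral_lintegral_of_invariant {α : Type*} [MeasurableSpace α] {K : Kernel α α}
    {μ : Measure α} (h : Kernel.Invariant K μ) {f : α → ℝ≥0∞} (hf : Measurable f) :
    ∫⁻ x, ∫⁻ y, f y ∂(K x) ∂μ = ∫⁻ x, f x ∂μ := by
  conv_rhs => rw [← h.def]
  rw [Measure.lintegral_bind K.aemeasurable hf.aemeasurable]

theorem compProd_walkKernel_apply {Q : Measure Env} [SFinite Q] (ϱ : ℕ∞)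
    {B : Set (Env × (ℕ → ℤ))} (hB : MeasurableSet B) :
    (Q ⊗ₘ walkKernel ϱ) B = ∫⁻ ω, walkLaw ϱ ω {S | (ω, S) ∈ B} ∂Q :=
  Measure.compProd_apply hB

theorem measurePreserving_skewShift {Q : Measure Env} [SFinite Q] {ϱ : ℕ∞}
    (hinv : Kernel.Invariant (envKernel ϱ) Q) :
    MeasurePreserving skewShift (Q ⊗ₘ walkKernel ϱ) (Q ⊗ₘ walkKernel ϱ) := by
  refine ⟨measurable_skewShift, ?_⟩
  ext B hB
  rw [Measure.map_apply measurable_skewShift hB,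
    compProd_walkKernel_apply ϱ (measurable_skewShift hB), compProd_walkKernel_apply ϱ hB,
    ← lintegral_lintegral_of_invariant hinv (measurable_walkLaw_section ϱ hB)]
  exact lintegral_congr fun ω => walkLaw_skewShift_preimage ϱ hB ω

/-- Bounded harmonic functions of the environment viewed from the particle are constant. -/
theorem exists_ae_eq_const_of_harmonic {P Q : Measure Env} [IsProbabilityMeasure P]
    [IsProbabilityMeasure Q] (hP : Ergodic (shift 1) P) {ϱ : ℕ∞}
    (hpos : ∀ᵐ ω ∂P, 0 < (truncate ϱ ω).1 0 1) (hPQ : P ≪ Q)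
    (hinv : Kernel.Invariant (envKernel ϱ) Q) {φ : Env → ℝ≥0∞} (hφ : Measurable φ)
    (hφ1 : ∀ ω, φ ω ≤ 1) (hharm : ∀ ω, φ ω = ∫⁻ η, φ η ∂(envKernel ϱ ω)) :
    ∃ c, ∀ᵐ ω ∂P, φ ω = c := by
  -- `(φ - a)⁺` is subharmonic and hence harmonic, so `φ ≤ a` is preserved by the jump to `1`
  have hlevel : ∀ a : ℚ, ∀ᵐ ω ∂P, φ ω ≤ (Real.toNNReal a : ℝ≥0∞) →
      φ (shift 1 ω) ≤ (Real.toNNReal a : ℝ≥0∞) := by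
    intro q
    set a : ℝ≥0∞ := (Real.toNNReal q : ℝ≥0∞) with ha
    have hψ : Measurable fun ω => φ ω - a := hφ.sub_const a
    have hsub : ∀ ω, φ ω - a ≤ ∫⁻ η, (φ η - a) ∂(envKernel ϱ ω) := by
      intro ω
      rw [tsub_le_iff_right, hharm ω]
      calc ∫⁻ η, φ η ∂(envKernel ϱ ω) ≤ ∫⁻ η, ((φ η - a) + a) ∂(envKernel ϱ ω) :=
            lintegral_mono fun η => le_tsub_add
        _ = _ := by rw [lintegral_add_right _ measurable_const]; simp
    have hfin : ∫⁻ ω, (φ ω - a) ∂Q ≠ ∞ := by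
      refine ne_top_of_le_ne_top ENNReal.one_ne_top ?_
      calc ∫⁻ ω, (φ ω - a) ∂Q ≤ ∫⁻ _, 1 ∂Q := lintegral_mono fun ω => tsub_le_self.trans (hφ1 ω)
        _ = 1 := by simp
    have heq := ae_eq_of_ae_le_of_lintegral_le (ae_of_all Q hsub) hfin
      hψ.lintegral_kernel.aemeasurable (lintegral_lintegral_of_invariant hinv hψ).le
    filter_upwards [hPQ.ae_le heq, hpos] with ω h1 h2 h3
    rw [tsub_eq_zero_of_le h3, lintegral_envKernel ϱ ω hψ, eq_comm, ENNReal.tsum_eq_zero] at h1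
    rcases mul_eq_zero.mp (h1 1) with h4 | h4
    · exact absurd (by exact_mod_cast h4) h2.ne'
    · exact tsub_eq_zero_iff_le.mp h4
  have hle : φ ∘ shift 1 ≤ᵐ[P] φ := by
    filter_upwards [ae_all_iff.mpr hlevel] with ω hω
    by_contra hlt
    obtain ⟨q, -, hq1, hq2⟩ := ENNReal.lt_iff_exists_rat_btwn.mp (not_le.mp hlt)
    exact absurd (hω q hq1.le) (not_le.mpr hq2)
  have hint : ∫⁻ ω, φ (shift 1 ω) ∂P = ∫⁻ ω, φ ω ∂P := hP.lintegral_comp hφ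
  have hfin : ∫⁻ ω, (φ ∘ shift 1) ω ∂P ≠ ∞ := by
    refine ne_top_of_le_ne_top ENNReal.one_ne_top ?_
    calc ∫⁻ ω, φ (shift 1 ω) ∂P ≤ ∫⁻ _, 1 ∂P := lintegral_mono fun ω => hφ1 _
      _ = 1 := by simp
  have heq := ae_eq_of_ae_le_of_lintegral_le hle hfin hφ.aemeasurable hint.ge
  obtain ⟨c, hc⟩ := hP.quasiErgodic.ae_eq_const_of_ae_eq_comp₀ hφ.nullMeasurable heq
  exact ⟨c, hc⟩

/-- If an event invariant under `skewShift` has the same quenched probability `c` in all translates of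
`ω`, then under the quenched law it is independent of the first `n` steps of the walk. -/
theorem walkLaw_inter_cyl {ϱ : ℕ∞} {A : Set (Env × (ℕ → ℤ))} (hA : MeasurableSet A)
    (hAinv : skewShift ⁻¹' A = A) {c : ℝ≥0∞} (n : ℕ) (a : ℕ → ℤ) {ω : Env}
    (hω : ∀ z, walkLaw ϱ (shift z ω) {S | (shift z ω, S) ∈ A} = c) :
    walkLaw ϱ ω ({S | (ω, S) ∈ A} ∩ cyl a n) = c * walkLaw ϱ ω (cyl a n) := by
  induction n generalizing ω a with
  | zero =>
    by_cases h0 : a 0 = 0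
    · have hcyl : walkLaw ϱ ω (cyl a 0) = 1 := by
        rw [walkLaw, quenchedLaw_cyl_zero, if_pos h0]
      have hcompl : walkLaw ϱ ω (cyl a 0)ᶜ = 0 :=
        (prob_compl_eq_zero_iff (measurableSet_cyl a 0)).mpr hcyl
      rw [measure_inter_conull hcompl, hcyl, mul_one]
      simpa [shift_zero] using hω 0
    · have hcyl : walkLaw ϱ ω (cyl a 0) = 0 := by
        rw [walkLaw, quenchedLaw_cyl_zero, if_neg h0]
      rw [hcyl, mul_zero]
      exact measure_mono_null Set.inter_subset_right hcyl
  | succ n ih =>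
    have hsec : {S | (ω, S) ∈ A} = {S | skewShift (ω, S) ∈ A} := by
      conv_lhs => rw [← hAinv]
      rfl
    have hm := measurableSet_section hA ω
    have hstep : ∀ y : ℤ, walkLaw ϱ (shift y ω)
        (consWalk y ⁻¹' ({S | (ω, S) ∈ A} ∩ cyl a (n + 1)))
        = c * walkLaw ϱ (shift y ω) (consWalk y ⁻¹' cyl a (n + 1)) := by
      intro y
      have hcongr : walkLaw ϱ (shift y ω)
          (consWalk y ⁻¹' {S | skewShift (ω, S) ∈ A} ∩ consWalk y ⁻¹' cyl a (n + 1))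
          = walkLaw ϱ (shift y ω) ({S | (shift y ω, S) ∈ A} ∩ consWalk y ⁻¹' cyl a (n + 1)) :=
        measure_congr ((walkLaw_consWalk_preimage ϱ ω y A).inter (ae_eq_refl _))
      rw [Set.preimage_inter, hsec, hcongr, consWalk_preimage_cyl_succ]
      split_ifs with h0
      · refine ih _ fun z => ?_
        rw [shift_shift]
        exact hω _
      · simp
    rw [walkLaw, quenchedLaw_apply_first_step _ (hm.inter (measurableSet_cyl _ _)),
      quenchedLaw_apply_first_step _ (measurableSet_cyl _ _), ← ENNReal.tsum_mul_left]
    refine tsum_congr fun y => ?_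
    rw [← truncate_shift]
    have h := hstep y
    rw [walkLaw] at h
    rw [h]
    ring

/-- The joint law of the environment and the walk is ergodic under `skewShift`: the probability of
an invariant event given the environment is a constant `c`, and `c = c * c` by independence. -/
theorem ergodic_skewShift {P Q : Measure Env} [IsProbabilityMeasure P]
    [IsProbabilityMeasure Q] (hP : Ergodic (shift 1) P) {ϱ : ℕ∞}
    (hpos : ∀ᵐ ω ∂P, 0 < (truncate ϱ ω).1 0 1) (hQP : Q ≪ P) (hPQ : P ≪ Q)
    (hinv : Kernel.Invariant (envKernel ϱ) Q) : Ergodic skewShift (Q ⊗ₘ walkKernel ϱ) := by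
  refine ⟨measurePreserving_skewShift hinv, ⟨fun {A} hA hAinv => ?_⟩⟩
  obtain ⟨c, hc⟩ := exists_ae_eq_const_of_harmonic hP hpos hPQ hinv
    (measurable_walkLaw_section ϱ hA) (fun ω => prob_le_one) (fun ω => by
      rw [← walkLaw_skewShift_preimage ϱ hA ω]
      conv_lhs => rw [← hAinv]
      rfl)
  have hc2 : c = c * c := by
    obtain ⟨ω, hω⟩ := (ae_forall_shift hP.toMeasurePreserving hc).exists
    have hω0 : walkLaw ϱ ω {S | (ω, S) ∈ A} = c := by simpa [shift_zero] using hω 0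
    have hmeas : (walkLaw ϱ ω).restrict {S | (ω, S) ∈ A} = c • walkLaw ϱ ω := by
      refine ext_of_cyl fun a n => ?_
      rw [Measure.restrict_apply (measurableSet_cyl a n), Set.inter_comm,
        walkLaw_inter_cyl hA hAinv n a hω]
      rfl
    have h1 : (walkLaw ϱ ω).restrict {S | (ω, S) ∈ A} {S | (ω, S) ∈ A}
        = (c • walkLaw ϱ ω) {S | (ω, S) ∈ A} := by rw [hmeas]
    rwa [Measure.restrict_apply_self, Measure.smul_apply, hω0] at h1
  have hmass : (Q ⊗ₘ walkKernel ϱ) A = c := by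
    rw [compProd_walkKernel_apply ϱ hA, lintegral_congr_ae (hQP.ae_le hc)]
    simp
  have hcfin : c ≠ ∞ := by rw [← hmass]; exact measure_ne_top _ _
  rw [eventuallyConst_set']
  rcases eq_or_ne c 0 with h0 | h0
  · exact Or.inl (ae_eq_empty.mpr (hmass.trans h0))
  · refine Or.inr (ae_eq_univ.mpr ((prob_compl_eq_zero_iff hA).mpr (hmass.trans ?_)))
    have : c * 1 = c * c := by rw [mul_one]; exact hc2
    exact ((ENNReal.mul_right_inj h0 hcfin).mp this).symm

theorem iterate_skewShift_snd {p : Env × (ℕ → ℤ)} (h0 : p.2 0 = 0) (n m : ℕ) :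
    (skewShift^[n] p).2 m = p.2 (n + m) - p.2 n := by
  induction n generalizing m with
  | zero => simp [h0]
  | succ n ih =>
    rw [Function.iterate_succ_apply']
    simp only [skewShift, ih]
    rw [show n + (m + 1) = n + 1 + m by ring]
    ring

theorem birkhoffSum_skewShift {p : Env × (ℕ → ℤ)} (h0 : p.2 0 = 0) (n : ℕ) :
    birkhoffSum skewShift (fun p : Env × (ℕ → ℤ) => (p.2 1 : ℝ)) n p = p.2 n := by
  rw [birkhoffSum]
  simp only [iterate_skewShift_snd h0]
  push_cast
  rw [Finset.sum_range_sub (fun k => (p.2 k : ℝ)), h0]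
  simp

theorem lintegral_walkLaw_one (ϱ : ℕ∞) (ω : Env) (f : ℤ → ℝ≥0∞) :
    ∫⁻ S, f (S 1) ∂(walkLaw ϱ ω) = ∑' y : ℤ, f y * (truncate ϱ ω).1 0 y := by
  have hm : Measurable fun S : ℕ → ℤ => S 1 := measurable_pi_apply 1
  rw [← lintegral_map (measurable_of_countable f) hm, lintegral_countable']
  refine tsum_congr fun y => ?_
  rw [Measure.map_apply hm (measurableSet_singleton y)]
  congr 1
  change quenchedLaw (truncate ϱ ω) 0 {S | S 1 = y} = _
  rw [quenchedLaw_coord_eq, nStep, tsum_eq_single y]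
  · simp [nStep]
  · intro z hz
    rw [nStep, if_neg (by omega), mul_zero]

theorem lintegral_enorm_walkLaw_one_le {ϱ : ℕ∞} {ω : Env} {t : ℕ → ℝ≥0∞}
    (ht : ∀ s : ℕ, 1 ≤ s →
      ∑' y : ℤ, (if s ≤ y.natAbs then ((truncate ϱ ω).1 0 y : ℝ≥0∞) else 0) ≤ t s) :
    ∫⁻ S, ‖(S 1 : ℝ)‖ₑ ∂(walkLaw ϱ ω) ≤ ∑' s, t (s + 1) := by
  rw [lintegral_walkLaw_one ϱ ω fun y => ‖(y : ℝ)‖ₑ]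
  refine le_trans (le_of_eq (tsum_congr fun y => ?_)) (tsum_natAbs_mul_le ht)
  congr 1
  rw [← ofReal_norm, Real.norm_eq_abs, ← Int.cast_abs, Int.abs_eq_natAbs, Int.cast_natCast,
    ENNReal.ofReal_natCast]

theorem measurable_coord_one : Measurable fun S : ℕ → ℤ => (S 1 : ℝ) :=
  (measurable_of_countable fun z : ℤ => (z : ℝ)).comp (measurable_pi_apply 1)

theorem integrable_walkLaw_one {ϱ : ℕ∞} {ω : Env} {t : ℕ → ℝ≥0∞} (htfin : ∑' s, t (s + 1) ≠ ∞)
    (ht : ∀ s : ℕ, 1 ≤ s →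
      ∑' y : ℤ, (if s ≤ y.natAbs then ((truncate ϱ ω).1 0 y : ℝ≥0∞) else 0) ≤ t s) :
    Integrable (fun S : ℕ → ℤ => (S 1 : ℝ)) (walkLaw ϱ ω) :=
  ⟨measurable_coord_one.aestronglyMeasurable,
    (lintegral_enorm_walkLaw_one_le ht).trans_lt htfin.lt_top⟩

theorem integrable_compProd_walkKernel {Q : Measure Env} [IsProbabilityMeasure Q] {ϱ : ℕ∞}
    {t : ℕ → ℝ≥0∞} (htfin : ∑' s, t (s + 1) ≠ ∞) (ht : ∀ᵐ ω ∂Q, ∀ s : ℕ, 1 ≤ s →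
      ∑' y : ℤ, (if s ≤ y.natAbs then ((truncate ϱ ω).1 0 y : ℝ≥0∞) else 0) ≤ t s) :
    Integrable (fun p : Env × (ℕ → ℤ) => (p.2 1 : ℝ)) (Q ⊗ₘ walkKernel ϱ) := by
  have hm : Measurable fun p : Env × (ℕ → ℤ) => (p.2 1 : ℝ) :=
    measurable_coord_one.comp measurable_snd
  refine ⟨hm.aestronglyMeasurable, ?_⟩
  rw [HasFiniteIntegral, Measure.lintegral_compProd hm.enorm]
  calc ∫⁻ ω, ∫⁻ S, ‖(S 1 : ℝ)‖ₑ ∂(walkLaw ϱ ω) ∂Q ≤ ∫⁻ _, ∑' s, t (s + 1) ∂Q :=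
        lintegral_mono_ae (ht.mono fun ω hω => lintegral_enorm_walkLaw_one_le hω)
    _ < ∞ := by simpa using htfin.lt_top

/-- The law of large numbers for the walk, with the mean drift under the invariant measure as
speed. -/
theorem ae_tendsto_div {P Q : Measure Env} [IsProbabilityMeasure P]
    [IsProbabilityMeasure Q] (hP : Ergodic (shift 1) P) {ϱ : ℕ∞}
    (hpos : ∀ᵐ ω ∂P, 0 < (truncate ϱ ω).1 0 1) (hQP : Q ≪ P) (hPQ : P ≪ Q)
    (hinv : Kernel.Invariant (envKernel ϱ) Q) {t : ℕ → ℝ≥0∞} (htfin : ∑' s, t (s + 1) ≠ ∞)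
    (ht : ∀ᵐ ω ∂Q, ∀ s : ℕ, 1 ≤ s →
      ∑' y : ℤ, (if s ≤ y.natAbs then ((truncate ϱ ω).1 0 y : ℝ≥0∞) else 0) ≤ t s) :
    ∀ᵐ ω ∂P, ∀ᵐ S ∂(walkLaw ϱ ω), Tendsto (fun n : ℕ => (S n : ℝ) / n) atTop
      (𝓝 (∫ ω, ∫ S, (S 1 : ℝ) ∂(walkLaw ϱ ω) ∂Q)) := by
  have hi := integrable_compProd_walkKernel htfin ht
  have h := tendsto_birkhoffSum_div (ergodic_skewShift hP hpos hQP hPQ hinv)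
    (measurable_coord_one.comp measurable_snd) hi
  have hval : ∫ p, ((fun S : ℕ → ℤ => (S 1 : ℝ)) ∘ Prod.snd) p ∂(Q ⊗ₘ walkKernel ϱ)
      = ∫ ω, ∫ S, (S 1 : ℝ) ∂(walkLaw ϱ ω) ∂Q := Measure.integral_compProd hi
  rw [hval] at h
  refine hPQ.ae_le ?_
  filter_upwards [Measure.ae_ae_of_ae_compProd h] with ω hω
  filter_upwards [hω, ae_quenchedLaw_zero (truncate ϱ ω)] with S h1 h2
  refine h1.congr fun n => ?_
  exact congrArg (· / (n : ℝ)) (birkhoffSum_skewShift (p := (ω, S)) h2 n)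

/-! ### A lower bound for the speed -/

theorem one_le_green_diag (ω : Env) (x : ℤ) : 1 ≤ green ω x x := by
  rw [green_last_step, if_pos rfl]
  exact le_self_add

theorem walkLaw_coord_le (ϱ : ℕ∞) (ω : Env) (k : ℕ) (K : ℤ) :
    walkLaw ϱ ω {S | S k ≤ K} ≤ ∑' m : ℕ, nStep (truncate ϱ ω) k 0 (K - m) := by
  have h : {S : ℕ → ℤ | S k ≤ K} ⊆ ⋃ m : ℕ, {S | S k = K - m} := by
    intro S hS
    have hS' : S k ≤ K := hS
    exact Set.mem_iUnion.mpr ⟨(K - S k).toNat, by simp only [Set.mem_ofPred_eq]; omega⟩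
  refine (measure_mono h).trans ((measure_iUnion_le _).trans (le_of_eq (tsum_congr fun m => ?_)))
  exact quenchedLaw_coord_eq _ _ _

/-- The speed is at least the inverse of the bound on the expected number of visits to a site: the
walk spends in `[0, n]` a time that is at most linear in `n`. -/
theorem inv_le_speed {ϱ : ℕ∞} {ω : Env} {ε : ℝ≥0∞} {t g : ℕ → ℝ≥0∞} {G : ℝ≥0} {v : ℝ}
    (hc : Controlled (truncate ϱ ω) ε t g) (hg : ∑' m, g m ≠ ∞) (hG : (G : ℝ≥0∞) = g 0)
    (hv : ∀ᵐ S ∂(walkLaw ϱ ω), Tendsto (fun n : ℕ => (S n : ℝ) / n) atTop (𝓝 v)) :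
    (G : ℝ)⁻¹ ≤ v := by
  have hGpos : (0 : ℝ) < G := by
    have h1 : (1 : ℝ≥0∞) ≤ G := by
      rw [hG]
      exact (one_le_green_diag _ 0).trans (green_le_zero_apply hc.green_le 0 0)
    have h2 : (1 : ℝ≥0) ≤ G := by exact_mod_cast h1
    exact_mod_cast zero_lt_one.trans_le h2
  by_contra! hcon
  obtain ⟨s, hs1, hs2⟩ := exists_between (max_lt hcon (inv_pos.mpr hGpos))
  have hs0 : 0 < s := (le_max_right v 0).trans_lt hs1
  have hsv : v < s := (le_max_left v 0).trans_lt hs1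
  -- if the speed were less than `s < 1 / G`, then `S k ≤ s * k` with probability tending to one, and
  -- the walk would spend a time close to `N` in `(-∞, s * N]`
  set E : ℕ → Set (ℕ → ℤ) := fun k => {S | (S k : ℝ) ≤ s * k} with hE
  have hEm : ∀ k, MeasurableSet (E k) := fun k =>
    measurableSet_le ((measurable_of_countable fun z : ℤ => (z : ℝ)).comp
      (measurable_pi_apply (X := fun _ : ℕ => ℤ) k)) measurable_const
  have hlim : Tendsto (fun k => walkLaw ϱ ω (E k)) atTop (𝓝 (walkLaw ϱ ω Set.univ)) := by
    refine tendsto_measure_of_ae_tendsto_indicator_of_isFiniteMeasure atTop MeasurableSet.univ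
      hEm ?_
    filter_upwards [hv] with S hS
    filter_upwards [hS.eventually_lt_const hsv, eventually_gt_atTop 0] with k hk hk0
    have hk' : (0 : ℝ) < k := by exact_mod_cast hk0
    simp only [hE, Set.mem_ofPred_eq, Set.mem_univ, iff_true]
    exact ((div_lt_iff₀ hk').mp hk).le
  rw [measure_univ] at hlim
  have hlimR : Tendsto (fun k => (walkLaw ϱ ω).real (E k)) atTop (𝓝 1) :=
    (ENNReal.tendsto_toReal ENNReal.one_ne_top).comp hlim
  have hces := hlimR.cesaro
  set B : ℝ := (∑' m, g m).toReal with hB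
  have hsum : ∀ N : ℕ, ∑ k ∈ Finset.range N, (walkLaw ϱ ω).real (E k) ≤ s * N * G + B := by
    intro N
    set K := ⌊s * N⌋₊ with hK
    have hKle : (K : ℝ) ≤ s * N := Nat.floor_le (by positivity)
    have h1 : ∑ k ∈ Finset.range N, walkLaw ϱ ω (E k) ≤ K * g 0 + ∑' m, g m := by
      have h2 := tsum_green_le hc.green_le 0 K
      simp only [zero_add] at h2
      refine le_trans ?_ h2
      simp only [green]
      rw [ENNReal.tsum_comm]
      refine le_trans (Finset.sum_le_sum fun k hk => ?_) (ENNReal.sum_le_tsum (Finset.range N))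
      refine le_trans (measure_mono ?_) (walkLaw_coord_le ϱ ω k K)
      intro S hS
      have hS' : (S k : ℝ) ≤ s * k := hS
      have hkN : (k : ℝ) ≤ N := by exact_mod_cast (Finset.mem_range.mp hk).le
      have h3 : (S k : ℝ) ≤ s * N := hS'.trans (by gcongr)
      have h4 : S k ≤ ⌊s * N⌋ := Int.le_floor.mpr h3
      have h5 : (K : ℤ) = ⌊s * N⌋ := Int.natCast_floor_eq_floor (by positivity)
      simp only [Set.mem_ofPred_eq]
      omega
    have h6 : (∑ k ∈ Finset.range N, walkLaw ϱ ω (E k)).toReal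
        = ∑ k ∈ Finset.range N, (walkLaw ϱ ω).real (E k) :=
      ENNReal.toReal_sum fun k _ => measure_ne_top _ _
    rw [← h6]
    have h7 : (K * g 0 + ∑' m, g m : ℝ≥0∞) ≠ ∞ := by
      rw [← hG]; finiteness
    refine (ENNReal.toReal_mono h7 h1).trans ?_
    rw [ENNReal.toReal_add (by rw [← hG]; finiteness) hg, ENNReal.toReal_mul, ← hG]
    simp only [ENNReal.toReal_natCast, ENNReal.coe_toReal]
    gcongr
  have hup : Tendsto (fun N : ℕ => s * G + B / N) atTop (𝓝 (s * G + 0)) :=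
    tendsto_const_nhds.add (tendsto_const_div_atTop_nhds_zero_nat B)
  have hle : (1 : ℝ) ≤ s * G + 0 := by
    refine le_of_tendsto_of_tendsto hces hup ?_
    filter_upwards [eventually_gt_atTop 0] with N hN
    have hN' : (0 : ℝ) < N := by exact_mod_cast hN
    calc (N : ℝ)⁻¹ * ∑ k ∈ Finset.range N, (walkLaw ϱ ω).real (E k)
        ≤ (N : ℝ)⁻¹ * (s * N * G + B) := by gcongr; exact hsum N
      _ = s * G + B / N := by field_simp
  rw [add_zero] at hle
  have := (lt_inv_comm₀ hs0 hGpos).mp hs2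
  have h8 : s * G < 1 := by
    rwa [← lt_div_iff₀ hGpos, one_div]
  linarith

/-! ### Removing the truncation -/

theorem TailBound.truncate {ω : Env} {t : ℕ → ℝ≥0∞} (h : TailBound ω t) (ϱ : ℕ∞) :
    TailBound (truncate ϱ ω) t := by
  intro x s hs
  refine le_trans (ENNReal.tsum_le_tsum fun y => ?_) (h x s hs)
  split_ifs with hy
  · exact_mod_cast truncate_coord_le ϱ ω x (by rintro rfl; simp at hy; omega)
  · exact le_rfl

theorem truncate_top (ω : Env) : truncate ⊤ ω = ω := by
  apply Subtype.ext
  funext x y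
  change truncFun ⊤ ω.1 x y = _
  unfold truncFun
  split_ifs with h1 h2
  · subst h1
    simp
  · rfl
  · exact absurd (ENat.natCast_lt_top _) h2

theorem envKernel_top_le {ω : Env} {t : ℕ → ℝ≥0∞} (h : TailBound ω t) {ϱ : ℕ} (hϱ : 1 ≤ ϱ)
    {A : Set Env} (hA : MeasurableSet A) : envKernel ⊤ ω A ≤ envKernel ϱ ω A + t ϱ := by
  refine le_trans ?_ (add_le_add le_rfl (h 0 ϱ hϱ))
  rw [envKernel_apply _ _ hA, envKernel_apply _ _ hA, ← ENNReal.tsum_add, truncate_top]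
  refine ENNReal.tsum_le_tsum fun y => ?_
  have hle1 : A.indicator (1 : Env → ℝ≥0∞) (shift y ω) ≤ 1 :=
    Set.indicator_le_self' (fun _ _ => zero_le) _
  by_cases hy : ϱ ≤ y.natAbs
  · rw [if_pos hy]
    exact (mul_le_of_le_one_right' hle1).trans le_add_self
  · refine le_trans ?_ le_self_add
    gcongr
    by_cases hy0 : y = 0
    · subst hy0
      change ω.1 0 0 ≤ truncFun ϱ ω.1 0 0
      rw [truncFun, if_pos rfl]
      exact le_self_add
    · rw [truncate_coord_of_lt _ _ _ hy0 (by exact_mod_cast not_le.mp hy)]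

/-- Setwise limits of invariant measures of the truncated chains are invariant for the chain
without truncation. -/
theorem invariant_top_of_tendsto {P : Measure Env} [IsProbabilityMeasure P] {t : ℕ → ℝ≥0∞}
    (htail : ∀ᵐ ω ∂P, TailBound ω t) (ht : Tendsto t atTop (𝓝 0)) {C : ℝ≥0}
    {Q : ℕ → Measure Env} {μ : Measure Env} {l : Filter ℕ} [l.NeBot] (hl : l ≤ atTop)
    (hQ : ∀ᶠ ϱ in l, IsProbabilityMeasure (Q ϱ) ∧ Kernel.Invariant (envKernel ϱ) (Q ϱ) ∧
      Q ϱ ≤ C • P)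
    (hμ : μ ≤ C • P) (hlim : ∀ A, MeasurableSet A → Tendsto (fun ϱ => Q ϱ A) l (𝓝 (μ A))) :
    Kernel.Invariant (envKernel ⊤) μ := by
  have hfin : IsFiniteMeasure μ := isFiniteMeasure_of_le _ hμ
  refine invariant_of_lintegral_le fun A hA => ?_
  have h1 := tendsto_lintegral_of_tendsto_measure (hQ.mono fun _ h => h.2.2) hμ hlim
    ((envKernel ⊤).measurable_coe hA) fun ω => prob_le_one
  have h2 := (hlim A hA).add (ht.mono_left hl)
  rw [add_zero] at h2
  refine le_of_tendsto_of_tendsto h1 h2 ?_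
  filter_upwards [hQ, hl (eventually_ge_atTop 1)] with ϱ ⟨hprob, hinv, hle⟩ hϱ
  have hac : Q ϱ ≪ P := Measure.absolutelyContinuous_of_le_smul hle
  calc ∫⁻ ω, envKernel ⊤ ω A ∂(Q ϱ) ≤ ∫⁻ ω, (envKernel ϱ ω A + t ϱ) ∂(Q ϱ) :=
        lintegral_mono_ae (hac.ae_le (htail.mono fun ω hω => envKernel_top_le hω hϱ hA))
    _ = ∫⁻ ω, envKernel ϱ ω A ∂(Q ϱ) + t ϱ := by
        rw [lintegral_add_right _ measurable_const]; simp
    _ = Q ϱ A + t ϱ := by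
        rw [← Measure.bind_apply hA (envKernel ϱ).aemeasurable, hinv.def]

/-! ### Convergence of the local drift -/

/-- The local drift `E_ω S₁` of the truncated walk. -/
noncomputable def drift (ϱ : ℕ∞) (ω : Env) : ℝ := ∫ S, (S 1 : ℝ) ∂(walkLaw ϱ ω)

theorem stronglyMeasurable_drift (ϱ : ℕ∞) : StronglyMeasurable (drift ϱ) := by
  have h : StronglyMeasurable fun p : Env × (ℕ → ℤ) => (p.2 1 : ℝ) :=
    (measurable_coord_one.comp measurable_snd).stronglyMeasurable
  exact h.integral_kernel_prod_right' (κ := walkKernel ϱ)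

theorem drift_eq_tsum {ϱ : ℕ∞} {ω : Env} {t : ℕ → ℝ≥0∞} (htfin : ∑' s, t (s + 1) ≠ ∞)
    (h : TailBound ω t) : drift ϱ ω = ∑' y : ℤ, ((truncate ϱ ω).1 0 y : ℝ) * y := by
  have hi := integrable_walkLaw_one htfin (h.truncate ϱ 0)
  have hm : Measurable fun S : ℕ → ℤ => S 1 := measurable_pi_apply 1
  have hcast : Measurable fun z : ℤ => (z : ℝ) := measurable_of_countable _
  have hi' : Integrable (fun z : ℤ => (z : ℝ)) ((walkLaw ϱ ω).map fun S => S 1) :=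
    (integrable_map_measure hcast.aestronglyMeasurable hm.aemeasurable).mpr hi
  rw [drift, ← integral_map (φ := fun S : ℕ → ℤ => S 1) (f := fun z : ℤ => (z : ℝ))
    hm.aemeasurable hcast.aestronglyMeasurable, integral_countable hi']
  refine tsum_congr fun y => ?_
  rw [smul_eq_mul]
  congr 1
  have h1 := lintegral_walkLaw_one ϱ ω (Set.indicator {y} 1)
  rw [tsum_eq_single y (by intro z hz; simp [hz])] at h1
  rw [measureReal_def, Measure.map_apply hm (measurableSet_singleton y),
    ← lintegral_indicator_one (hm (measurableSet_singleton y))]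
  have h2 : ∀ S : ℕ → ℤ, ((fun S : ℕ → ℤ => S 1) ⁻¹' {y}).indicator (1 : (ℕ → ℤ) → ℝ≥0∞) S
      = Set.indicator {y} 1 (S 1) := fun S => rfl
  simp only [h2, h1]
  simp

theorem abs_drift_le {ϱ : ℕ∞} {ω : Env} {t : ℕ → ℝ≥0∞} (htfin : ∑' s, t (s + 1) ≠ ∞)
    (h : TailBound ω t) : |drift ϱ ω| ≤ (∑' s, t (s + 1)).toReal := by
  rw [← Real.norm_eq_abs, ← toReal_enorm]
  exact ENNReal.toReal_mono htfin ((enorm_integral_le_lintegral_enorm _).trans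
    (lintegral_enorm_walkLaw_one_le (h.truncate ϱ 0)))

theorem tendsto_drift {ω : Env} {t : ℕ → ℝ≥0∞} (htfin : ∑' s, t (s + 1) ≠ ∞)
    (h : TailBound ω t) : Tendsto (fun ϱ : ℕ => drift ϱ ω) atTop (𝓝 (drift ⊤ ω)) := by
  simp only [drift_eq_tsum htfin h]
  have hsum : Summable fun y : ℤ => (y.natAbs : ℝ) * (ω.1 0 y : ℝ) := by
    have h1 := ne_top_of_le_ne_top htfin (tsum_natAbs_mul_le (h 0))
    have h2 := ENNReal.summable_toReal h1
    simpa using h2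
  refine tendsto_tsum_of_dominated_convergence hsum (fun y => ?_) (Eventually.of_forall ?_)
  · refine tendsto_const_nhds.congr' ?_
    filter_upwards [eventually_gt_atTop y.natAbs] with ϱ hϱ
    by_cases hy : y = 0
    · simp [hy]
    · rw [truncate_top, truncate_coord_of_lt _ _ _ hy (by exact_mod_cast hϱ)]
  · intro ϱ y
    by_cases hy : y = 0
    · simp [hy]
    · rw [norm_mul, mul_comm, Real.norm_eq_abs, ← Int.cast_abs, Int.abs_eq_natAbs, Int.cast_natCast]
      gcongr
      rw [Real.norm_of_nonneg (NNReal.coe_nonneg _)]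
      exact_mod_cast truncate_coord_le ϱ ω 0 hy

theorem tendsto_integral_drift {P : Measure Env} [IsProbabilityMeasure P] {t : ℕ → ℝ≥0∞}
    (htfin : ∑' s, t (s + 1) ≠ ∞) (htail : ∀ᵐ ω ∂P, TailBound ω t) {C : ℝ≥0}
    {Q : ℕ → Measure Env} {μ : Measure Env} (hQ : ∀ᶠ ϱ in atTop, Q ϱ ≤ C • P) (hμ : μ ≤ C • P)
    (hlim : ∀ A, MeasurableSet A → Tendsto (fun ϱ => Q ϱ A) atTop (𝓝 (μ A))) :
    Tendsto (fun ϱ : ℕ => ∫ ω, drift ϱ ω ∂(Q ϱ)) atTop (𝓝 (∫ ω, drift ⊤ ω ∂μ)) := by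
  set D : ℝ := (∑' s, t (s + 1)).toReal with hD
  have hint : ∀ ϱ, Integrable (drift ϱ) P := fun ϱ =>
    Integrable.of_bound (stronglyMeasurable_drift ϱ).aestronglyMeasurable D
      (htail.mono fun ω hω => abs_drift_le htfin hω)
  have h1 := tendsto_integral_of_tendsto_measure hQ hμ hlim (hint ⊤)
  have h2 : Tendsto (fun ϱ : ℕ => C * ∫ ω, |drift ϱ ω - drift ⊤ ω| ∂P) atTop (𝓝 (C * 0)) := by
    refine Tendsto.const_mul _ ?_
    have h3 : Tendsto (fun ϱ : ℕ => ∫ ω, |drift ϱ ω - drift ⊤ ω| ∂P) atTop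
        (𝓝 (∫ _, (0 : ℝ) ∂P)) := by
      refine tendsto_integral_of_dominated_convergence (fun _ => D + D) (fun ϱ => ?_)
        (integrable_const _) (fun ϱ => ?_) ?_
      · exact ((hint ϱ).sub (hint ⊤)).abs.aestronglyMeasurable
      · filter_upwards [htail] with ω hω
        rw [Real.norm_eq_abs, abs_abs]
        exact (abs_sub _ _).trans (add_le_add (abs_drift_le htfin hω) (abs_drift_le htfin hω))
      · filter_upwards [htail] with ω hω
        have h4 := ((tendsto_drift htfin hω).sub_const (drift ⊤ ω)).abs
        simpa using h4
    simpa using h3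
  rw [mul_zero] at h2
  have h5 : Tendsto (fun ϱ : ℕ => ∫ ω, drift ϱ ω ∂(Q ϱ) - ∫ ω, drift ⊤ ω ∂(Q ϱ)) atTop (𝓝 0) := by
    refine squeeze_zero_norm' ?_ h2
    filter_upwards [hQ] with ϱ hle
    have hi : ∀ {f : Env → ℝ}, Integrable f P → Integrable f (Q ϱ) := fun hf =>
      (hf.smul_measure_nnreal (c := C)).mono_measure hle
    rw [← integral_sub (hi (hint ϱ)) (hi (hint ⊤))]
    calc ‖∫ ω, (drift ϱ ω - drift ⊤ ω) ∂(Q ϱ)‖ ≤ ∫ ω, |drift ϱ ω - drift ⊤ ω| ∂(Q ϱ) :=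
          norm_integral_le_integral_norm _
      _ ≤ ∫ ω, |drift ϱ ω - drift ⊤ ω| ∂(C • P) :=
          integral_mono_measure hle (ae_of_all _ fun _ => abs_nonneg _)
            ((hint ϱ).sub (hint ⊤)).abs.smul_measure_nnreal
      _ = C * ∫ ω, |drift ϱ ω - drift ⊤ ω| ∂P := by rw [integral_smul_nnreal_measure]; rfl
  have h6 := h5.add h1
  simpa using h6

/-! ### The conditions E, C and D at all sites -/

theorem ConditionE.exists_nnreal {P : Measure Env} [IsProbabilityMeasure P] (hE : ConditionE P) :
    ∃ ε : ℝ≥0, 0 < ε ∧ ε ≤ 1 ∧ ∀ᵐ ω ∂P, ε ≤ ω.1 0 1 := by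
  obtain ⟨ε, hε, h⟩ := hE
  have h' : ∀ᵐ ω ∂P, ε.toNNReal ≤ ω.1 0 1 := h.mono fun ω hω => Real.toNNReal_le_iff_le_coe.mpr hω
  refine ⟨ε.toNNReal, Real.toNNReal_pos.mpr hε, ?_, h'⟩
  obtain ⟨ω, hω⟩ := h'.exists
  exact hω.trans (((ω.2 0).summable.le_tsum 1 fun _ _ => zero_le).trans (ω.2 0).tsum_eq.le)

theorem ConditionC.exists_tailBound {P : Measure Env} (hP : MeasurePreserving (shift 1) P P)
    (hC : ConditionC P) :
    ∃ t : ℕ → ℝ≥0∞, ∑' s, t (s + 1) ≠ ∞ ∧ ∀ᵐ ω ∂P, TailBound ω t := by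
  obtain ⟨γ, α, hγ, hα, h⟩ := hC
  refine ⟨fun s => ENNReal.ofReal (γ * (s : ℝ) ^ (-α)), ?_, ?_⟩
  · have hs : Summable fun s : ℕ => γ * (s : ℝ) ^ (-α) :=
      (Real.summable_nat_rpow.mpr (by linarith)).mul_left γ
    exact ((summable_nat_add_iff 1).mpr hs).tsum_ofReal_ne_top
  · have h0 : ∀ᵐ ω ∂P, ∀ s : ℕ, 1 ≤ s →
        ∑' y : ℤ, (if s ≤ y.natAbs then (ω.1 0 y : ℝ≥0∞) else 0)
          ≤ ENNReal.ofReal (γ * (s : ℝ) ^ (-α)) := by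
      rw [ae_all_iff]
      intro s
      by_cases hs : 1 ≤ s
      · filter_upwards [h s (by exact_mod_cast hs)] with ω hω _
        have hsum : Summable fun y : ℤ => if (s : ℝ) ≤ |(y : ℝ)| then (ω.1 0 y : ℝ) else 0 := by
          refine Summable.of_nonneg_of_le (fun y => ?_) (fun y => ?_)
            (NNReal.summable_coe.mpr (ω.2 0).summable)
          · split_ifs <;> simp
          · split_ifs <;> simp
        refine le_trans (le_of_eq ?_) (ENNReal.ofReal_le_ofReal hω)
        rw [ENNReal.ofReal_tsum_of_nonneg (fun y => by split_ifs <;> simp) hsum]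
        refine tsum_congr fun y => ?_
        have hiff : (s : ℝ) ≤ |(y : ℝ)| ↔ s ≤ y.natAbs := by
          rw [← Int.cast_abs, Int.abs_eq_natAbs, Int.cast_natCast, Nat.cast_le]
        simp only [hiff]
        split_ifs <;> simp
      · exact ae_of_all _ fun ω h1 => absurd h1 hs
    filter_upwards [ae_forall_shift hP h0] with ω hω x s hs
    simpa using hω x s hs

theorem ConditionD.exists_green_le {P : Measure Env} (hP : MeasurePreserving (shift 1) P P)
    {ϱ₀ : ℕ} (hD : ConditionD P ϱ₀) :
    ∃ g : ℕ → ℝ≥0∞, ∑' m, g m ≠ ∞ ∧ ∀ ϱ : ℕ, ϱ₀ ≤ ϱ →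
      ∀ᵐ ω ∂P, ∀ x y, y ≤ x → green (truncate ϱ ω) x y ≤ g (x - y).natAbs := by
  obtain ⟨g, hg0, -, hgs, h⟩ := hD
  refine ⟨fun k => ENNReal.ofReal (g k), ?_, fun ϱ hϱ => ?_⟩
  · refine Summable.tsum_ofReal_ne_top ?_
    refine (summable_nat_add_iff 1).mp ?_
    refine Summable.of_nonneg_of_le (fun k => hg0 _) (fun k => ?_)
      ((summable_nat_add_iff 1).mpr hgs)
    refine le_mul_of_one_le_left (hg0 _) ?_
    push_cast
    linarith [(Nat.cast_nonneg k : (0 : ℝ) ≤ k)]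
  · have h0 : ∀ᵐ ω ∂P, ∀ x : ℤ, x ≤ 0 →
        green (truncate ϱ ω) 0 x ≤ ENNReal.ofReal (g x.natAbs) := by
      rw [ae_all_iff]
      intro x
      by_cases hx : x ≤ 0
      · filter_upwards [h x hx ϱ hϱ] with ω hω _
        rwa [walkLaw, lintegral_visits] at hω
      · exact ae_of_all _ fun ω h1 => absurd h1 hx
    filter_upwards [ae_forall_shift hP h0] with ω hω x y hyx
    have h1 := hω x (y - x) (by omega)
    rw [truncate_shift, green_shift, zero_add, sub_add_cancel] at h1
    rwa [← Int.natAbs_neg, neg_sub] at h1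

/-- Bounds between measures as bounds on the Radon-Nikodym derivative. -/
theorem const_le_rnDeriv_le {α : Type*} [MeasurableSpace α] {P Q : Measure α} [IsFiniteMeasure P]
    [IsFiniteMeasure Q] {c C : ℝ≥0} (hc : c • P ≤ Q) (hC : Q ≤ C • P) :
    ∀ᵐ x ∂P, (c : ℝ≥0∞) ≤ Q.rnDeriv P x ∧ Q.rnDeriv P x ≤ C := by
  have hac : Q ≪ P := Measure.absolutelyContinuous_of_le_smul hC
  have h1 : (fun _ => (c : ℝ≥0∞)) ≤ᵐ[P] Q.rnDeriv P := by
    refine ae_le_of_forall_setLIntegral_le_of_sigmaFinite measurable_const fun s hs _ => ?_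
    rw [Measure.setLIntegral_rnDeriv hac, setLIntegral_const]
    exact hc s
  have h2 : Q.rnDeriv P ≤ᵐ[P] fun _ => (C : ℝ≥0∞) := by
    refine ae_le_of_forall_setLIntegral_le_of_sigmaFinite (Measure.measurable_rnDeriv Q P)
      fun s hs _ => ?_
    rw [Measure.setLIntegral_rnDeriv hac, setLIntegral_const]
    exact hC s
  filter_upwards [h1, h2] with x hx1 hx2 using ⟨hx1, hx2⟩

theorem absolutelyContinuous_of_smul_le {α : Type*} [MeasurableSpace α] {P Q : Measure α}
    {c : ℝ≥0} (hc0 : 0 < c) (hc : c • P ≤ Q) : P ≪ Q := by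
  refine Measure.AbsolutelyContinuous.mk fun s _ h0 => ?_
  have h1 : (c • P) s = 0 := le_antisymm ((hc s).trans h0.le) zero_le
  rw [Measure.smul_apply, ENNReal.smul_def, smul_eq_mul, mul_eq_zero] at h1
  exact h1.resolve_left (by exact_mod_cast hc0.ne')

/-! ### Existence for all truncation levels -/

theorem ae_controlled {P : Measure Env} (hP : MeasurePreserving (shift 1) P P) {ε : ℝ≥0}
    (hε : ∀ᵐ ω ∂P, ε ≤ ω.1 0 1) {t g : ℕ → ℝ≥0∞} (htail : ∀ᵐ ω ∂P, TailBound ω t) {ϱ : ℕ}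
    (hϱ : 1 < ϱ)
    (hgreen : ∀ᵐ ω ∂P, ∀ x y, y ≤ x → green (truncate ϱ ω) x y ≤ g (x - y).natAbs) :
    ∀ᵐ ω ∂P, Controlled (truncate ϱ ω) ε t g := by
  filter_upwards [hgreen, htail, ae_forall_shift hP hε] with ω h1 h2 h3
  refine ⟨fun x => ?_, h2.truncate ϱ, h1⟩
  rw [truncate_coord_one (by exact_mod_cast hϱ)]
  have := h3 x
  rw [shift_coord, zero_add] at this
  exact_mod_cast this

theorem Controlled.one_le {η : Env} {ε : ℝ≥0∞} {t g : ℕ → ℝ≥0∞} (h : Controlled η ε t g) :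
    1 ≤ g 0 :=
  (one_le_green_diag η 0).trans (green_le_zero_apply h.green_le 0 0)

/-- Invariant measures with uniformly bounded densities exist for all truncation levels, and the
speed is bounded below uniformly for the finite ones. -/
theorem exists_invariant_uniform {P : Measure Env} [IsProbabilityMeasure P]
    (hP : Ergodic (shift 1) P) {ε : ℝ≥0} (hε0 : 0 < ε) (hε1 : ε ≤ 1)
    (hε : ∀ᵐ ω ∂P, ε ≤ ω.1 0 1) {t g : ℕ → ℝ≥0∞} (htfin : ∑' s, t (s + 1) ≠ ∞)
    (htail : ∀ᵐ ω ∂P, TailBound ω t) (hg : ∑' m, g m ≠ ∞) {ϱ₀ : ℕ} (hϱ₀ : 1 < ϱ₀)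
    (hgreen : ∀ ϱ : ℕ, ϱ₀ ≤ ϱ →
      ∀ᵐ ω ∂P, ∀ x y, y ≤ x → green (truncate ϱ ω) x y ≤ g (x - y).natAbs) :
    ∃ c C : ℝ≥0, 0 < c ∧ ∀ ϱ : ℕ∞, (ϱ₀ : ℕ∞) ≤ ϱ → ∃ Q : Measure Env,
      IsProbabilityMeasure Q ∧ Kernel.Invariant (envKernel ϱ) Q ∧ c • P ≤ Q ∧ Q ≤ C • P := by
  have hctrl : ∀ ϱ : ℕ, ϱ₀ ≤ ϱ → ∀ᵐ ω ∂P, Controlled (truncate ϱ ω) ε t g := fun ϱ hϱ =>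
    ae_controlled hP.toMeasurePreserving hε htail (hϱ₀.trans_le hϱ) (hgreen ϱ hϱ)
  have hg0 : g 0 ≠ ∞ := ENNReal.ne_top_of_tsum_ne_top hg 0
  obtain ⟨M, hM0, hM⟩ : ∃ M : ℕ, 1 ≤ M ∧ g 0 * ∑' m, t (m + M + 1) ≤ 2⁻¹ := by
    have h1 := ENNReal.tendsto_sum_nat_add (fun s => t (s + 1)) htfin
    have h2 : Tendsto (fun M => g 0 * ∑' m, t (m + M + 1)) atTop (𝓝 (g 0 * 0)) :=
      ENNReal.Tendsto.const_mul h1 (Or.inr hg0)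
    rw [mul_zero] at h2
    have h3 := h2.eventually_le_const (u := 2⁻¹) (by simp)
    obtain ⟨M, h4, h5⟩ := (h3.and (eventually_ge_atTop 1)).exists
    exact ⟨M, h5, h4⟩
  set δ : ℝ≥0 := ε ^ M * 2⁻¹ / M with hδ
  have hMpos : (0 : ℝ≥0) < M := by exact_mod_cast hM0
  have hδ0 : 0 < δ := by positivity
  have hδ' : (δ : ℝ≥0∞) = (ε : ℝ≥0∞) ^ M * 2⁻¹ / M := by
    rw [hδ, ENNReal.coe_div hMpos.ne', ENNReal.coe_mul, ENNReal.coe_pow,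
      ENNReal.coe_inv two_ne_zero]
    simp
  set G : ℝ≥0 := (g 0).toNNReal with hGdef
  have hG : (G : ℝ≥0∞) = g 0 := ENNReal.coe_toNNReal hg0
  have hfinite : ∀ ϱ : ℕ, ϱ₀ ≤ ϱ → ∃ Q : Measure Env, IsProbabilityMeasure Q ∧
      Kernel.Invariant (envKernel ϱ) Q ∧ (δ / G) • P ≤ Q ∧ Q ≤ (G / δ) • P := fun ϱ hϱ =>
    exists_invariant hP.toMeasurePreserving (hctrl ϱ hϱ) hg htfin (by exact_mod_cast hε1) hM hδ0
      hδ' hG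
  have hGpos : 0 < G := by
    obtain ⟨ω, hω⟩ := (hctrl ϱ₀ le_rfl).exists
    have h1 : (1 : ℝ≥0∞) ≤ G := hG ▸ hω.one_le
    exact zero_lt_one.trans_le (by exact_mod_cast h1)
  refine ⟨δ / G, G / δ, div_pos hδ0 hGpos, fun ϱ hϱ => ?_⟩
  induction ϱ using ENat.recTopCoe with
  | coe ϱ => exact hfinite ϱ (by exact_mod_cast hϱ)
  | top =>
    choose! Q hQ using hfinite
    set U : Ultrafilter ℕ := Ultrafilter.of atTop
    have hU : (U : Filter ℕ) ≤ atTop := Ultrafilter.of_le atTop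
    have hev : ∀ᶠ ϱ in (U : Filter ℕ), ϱ₀ ≤ ϱ := hU (eventually_ge_atTop ϱ₀)
    obtain ⟨μ, hμ, hlim⟩ := exists_tendsto_measure_of_le Q U (hev.mono fun ϱ h => (hQ ϱ h).2.2.2)
    have ht0 : Tendsto t atTop (𝓝 0) :=
      (tendsto_add_atTop_iff_nat 1).mp (ENNReal.tendsto_atTop_zero_of_tsum_ne_top htfin)
    refine ⟨μ, ⟨?_⟩, invariant_top_of_tendsto htail ht0 hU
      (hev.mono fun ϱ h => ⟨(hQ ϱ h).1, (hQ ϱ h).2.1, (hQ ϱ h).2.2.2⟩) hμ hlim, ?_, hμ⟩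
    · refine tendsto_nhds_unique (hlim _ MeasurableSet.univ) (tendsto_const_nhds.congr' ?_)
      filter_upwards [hev] with ϱ h
      have := (hQ ϱ h).1
      exact measure_univ.symm
    · rw [Measure.le_iff]
      exact fun A hA => ge_of_tendsto (hlim A hA) (hev.mono fun ϱ h => (hQ ϱ h).2.2.1 A)

/-- Invariant measures of the truncated chains converge setwise to the one of the chain without
truncation, because the latter is unique. -/
theorem tendsto_measure_of_invariant {P : Measure Env} [IsProbabilityMeasure P] {t : ℕ → ℝ≥0∞}
    (htail : ∀ᵐ ω ∂P, TailBound ω t) (ht : Tendsto t atTop (𝓝 0)) {C : ℝ≥0}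
    {Q : ℕ → Measure Env} {μ : Measure Env}
    (hQ : ∀ᶠ ϱ in atTop, IsProbabilityMeasure (Q ϱ) ∧ Kernel.Invariant (envKernel ϱ) (Q ϱ) ∧
      Q ϱ ≤ C • P)
    (huniq : ∀ ν : Measure Env, IsProbabilityMeasure ν → ν ≪ P →
      Kernel.Invariant (envKernel ⊤) ν → ν = μ) {A : Set Env} (hA : MeasurableSet A) :
    Tendsto (fun ϱ => Q ϱ A) atTop (𝓝 (μ A)) := by
  rw [tendsto_iff_ultrafilter]
  intro U hU
  have hev := hQ.filter_mono hU
  obtain ⟨ν, hν, hlim⟩ := exists_tendsto_measure_of_le Q U (hev.mono fun ϱ h => h.2.2)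
  have hprob : IsProbabilityMeasure ν := by
    refine ⟨tendsto_nhds_unique (hlim _ MeasurableSet.univ) (tendsto_const_nhds.congr' ?_)⟩
    filter_upwards [hev] with ϱ h
    have := h.1
    exact measure_univ.symm
  rw [← huniq ν hprob (Measure.absolutelyContinuous_of_le_smul hν)
    (invariant_top_of_tendsto htail ht hU hev hν hlim)]
  exact hlim A hA

end RWRE

open RWRE in
theorem theorem2p3 (P : Measure RWRE.Env) [IsProbabilityMeasure P]
    (hP : Ergodic (RWRE.shift 1) P)
    (hE : RWRE.ConditionE P) (hC : RWRE.ConditionC P)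
    (ϱ₀ : ℕ) (hϱ₀ : 1 < ϱ₀) (hD : RWRE.ConditionD P ϱ₀) :
    ∃ (Q : ℕ∞ → ProbabilityMeasure RWRE.Env) (v : ℕ∞ → ℝ),
      (∀ ϱ : ℕ∞, (ϱ₀ : ℕ∞) ≤ ϱ →
        -- `v ϱ` is the (positive) speed of the walk
        (0 < v ϱ ∧ ∀ᵐ ω ∂P, ∀ᵐ S ∂(RWRE.walkLaw ϱ ω),
          Tendsto (fun n : ℕ => (S n : ℝ) / n) atTop (𝓝 (v ϱ))) ∧
        -- `Q ϱ` is the unique invariant probability measure absolutely continuous w.r.t. `P`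
        (Q ϱ : Measure RWRE.Env) ≪ P ∧
        Kernel.Invariant (RWRE.envKernel ϱ) (Q ϱ : Measure RWRE.Env) ∧
        (∀ Q' : Measure RWRE.Env, IsProbabilityMeasure Q' → Q' ≪ P →
          Kernel.Invariant (RWRE.envKernel ϱ) Q' → Q' = (Q ϱ : Measure RWRE.Env)) ∧
        -- it is ergodic
        RWRE.IsErgodicInvariant (RWRE.envKernel ϱ) (Q ϱ : Measure RWRE.Env) ∧
        -- formula for the speed
        (∀ᵐ ω ∂(Q ϱ : Measure RWRE.Env),
          Integrable (fun S : ℕ → ℤ => (S 1 : ℝ)) (RWRE.walkLaw ϱ ω)) ∧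
        Integrable (fun ω => ∫ S, (S 1 : ℝ) ∂(RWRE.walkLaw ϱ ω)) (Q ϱ : Measure RWRE.Env) ∧
        v ϱ = ∫ ω, ∫ S, (S 1 : ℝ) ∂(RWRE.walkLaw ϱ ω) ∂(Q ϱ : Measure RWRE.Env)) ∧
      -- the densities are bounded above and below uniformly in `ϱ`
      (∃ c C : ℝ, 0 < c ∧ ∀ ϱ : ℕ∞, (ϱ₀ : ℕ∞) ≤ ϱ →
        ∀ᵐ ω ∂P, ENNReal.ofReal c ≤ (Q ϱ : Measure RWRE.Env).rnDeriv P ω ∧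
          (Q ϱ : Measure RWRE.Env).rnDeriv P ω ≤ ENNReal.ofReal C) ∧
      Tendsto (fun ϱ : ℕ => Q ϱ) atTop (𝓝 (Q ⊤)) ∧
      Tendsto (fun ϱ : ℕ => v ϱ) atTop (𝓝 (v ⊤)) := by
  have hPm := hP.toMeasurePreserving
  obtain ⟨ε, hε0, hε1, hε⟩ := hE.exists_nnreal
  obtain ⟨t, htfin, htail⟩ := hC.exists_tailBound hPm
  obtain ⟨g, hg, hgreen⟩ := hD.exists_green_le hPm
  have ht0 : Tendsto t atTop (𝓝 0) :=
    (tendsto_add_atTop_iff_nat 1).mp (ENNReal.tendsto_atTop_zero_of_tsum_ne_top htfin)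
  obtain ⟨c, C, hc0, hex⟩ :=
    exists_invariant_uniform hP hε0 hε1 hε htfin htail hg hϱ₀ hgreen
  choose! Q hQprob hQinv hQlow hQup using hex
  have hQP : ∀ ϱ : ℕ∞, (ϱ₀ : ℕ∞) ≤ ϱ → Q ϱ ≪ P := fun ϱ hϱ =>
    Measure.absolutelyContinuous_of_le_smul (hQup ϱ hϱ)
  have hPQ : ∀ ϱ : ℕ∞, (ϱ₀ : ℕ∞) ≤ ϱ → P ≪ Q ϱ := fun ϱ hϱ =>
    absolutelyContinuous_of_smul_le hc0 (hQlow ϱ hϱ)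
  have hpos : ∀ ϱ : ℕ∞, (ϱ₀ : ℕ∞) ≤ ϱ → ∀ᵐ ω ∂P, 0 < (truncate ϱ ω).1 0 1 := by
    intro ϱ hϱ
    filter_upwards [hε] with ω hω
    rw [truncate_coord_one (lt_of_lt_of_le (by exact_mod_cast hϱ₀) hϱ)]
    exact hε0.trans_le hω
  have herg : ∀ ϱ : ℕ∞, (ϱ₀ : ℕ∞) ≤ ϱ → IsErgodicInvariant (envKernel ϱ) (Q ϱ) := fun ϱ hϱ =>
    isErgodicInvariant_envKernel hP (hpos ϱ hϱ) (hQP ϱ hϱ) (hPQ ϱ hϱ) (hQinv ϱ hϱ)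
  have huniq : ∀ ϱ : ℕ∞, (ϱ₀ : ℕ∞) ≤ ϱ → ∀ Q' : Measure Env, IsProbabilityMeasure Q' → Q' ≪ P →
      Kernel.Invariant (envKernel ϱ) Q' → Q' = Q ϱ := by
    intro ϱ hϱ Q' hQ' hac hinv
    have := hQprob ϱ hϱ
    exact (herg ϱ hϱ).eq_of_absolutelyContinuous hinv (hac.trans (hPQ ϱ hϱ))
  have htailQ : ∀ ϱ : ℕ∞, (ϱ₀ : ℕ∞) ≤ ϱ → ∀ᵐ ω ∂(Q ϱ), TailBound ω t := fun ϱ hϱ =>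
    (hQP ϱ hϱ).ae_le htail
  have hlln : ∀ ϱ : ℕ∞, (ϱ₀ : ℕ∞) ≤ ϱ → ∀ᵐ ω ∂P, ∀ᵐ S ∂(walkLaw ϱ ω),
      Tendsto (fun n : ℕ => (S n : ℝ) / n) atTop (𝓝 (∫ ω, drift ϱ ω ∂(Q ϱ))) := by
    intro ϱ hϱ
    have := hQprob ϱ hϱ
    exact ae_tendsto_div hP (hpos ϱ hϱ) (hQP ϱ hϱ) (hPQ ϱ hϱ) (hQinv ϱ hϱ) htfin
      ((htailQ ϱ hϱ).mono fun ω hω => hω.truncate ϱ 0)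
  have htop : (ϱ₀ : ℕ∞) ≤ ⊤ := le_top
  have hev : ∀ᶠ ϱ : ℕ in atTop, (ϱ₀ : ℕ∞) ≤ ϱ :=
    (eventually_ge_atTop ϱ₀).mono fun ϱ h => by exact_mod_cast h
  have hset : ∀ A, MeasurableSet A → Tendsto (fun ϱ : ℕ => Q ϱ A) atTop (𝓝 (Q ⊤ A)) := fun A hA =>
    tendsto_measure_of_invariant (C := C) (Q := fun ϱ : ℕ => Q ϱ) htail ht0
      (hev.mono fun ϱ h => ⟨hQprob ϱ h, hQinv ϱ h, hQup ϱ h⟩) (huniq ⊤ htop) hA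
  have hevC : ∀ᶠ ϱ : ℕ in atTop, Q ϱ ≤ C • P := hev.mono fun ϱ h => hQup ϱ h
  have hspeed : Tendsto (fun ϱ : ℕ => ∫ ω, drift ϱ ω ∂(Q ϱ)) atTop
      (𝓝 (∫ ω, drift ⊤ ω ∂(Q ⊤))) :=
    tendsto_integral_drift (Q := fun ϱ : ℕ => Q ϱ) htfin htail hevC (hQup ⊤ htop) hset
  obtain ⟨G, hG0, hlow⟩ : ∃ G : ℝ, 0 < G ∧ ∀ ϱ : ℕ, ϱ₀ ≤ ϱ → G ≤ ∫ ω, drift ϱ ω ∂(Q ϱ) := by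
    have hg0 : g 0 ≠ ∞ := ENNReal.ne_top_of_tsum_ne_top hg 0
    have hctrl : ∀ ϱ : ℕ, ϱ₀ ≤ ϱ → ∀ᵐ ω ∂P, Controlled (truncate ϱ ω) ε t g := fun ϱ hϱ =>
      ae_controlled hPm hε htail (hϱ₀.trans_le hϱ) (hgreen ϱ hϱ)
    refine ⟨((g 0).toNNReal : ℝ)⁻¹, inv_pos.mpr ?_, fun ϱ hϱ => ?_⟩
    · obtain ⟨ω, hω⟩ := (hctrl ϱ₀ le_rfl).exists
      exact NNReal.coe_pos.mpr (ENNReal.toNNReal_pos (zero_lt_one.trans_le hω.one_le).ne' hg0)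
    · obtain ⟨ω, hω, hv⟩ := ((hctrl ϱ hϱ).and (hlln ϱ (by exact_mod_cast hϱ))).exists
      exact inv_le_speed hω hg (ENNReal.coe_toNNReal hg0) hv
  have hvpos : ∀ ϱ : ℕ∞, (ϱ₀ : ℕ∞) ≤ ϱ → 0 < ∫ ω, drift ϱ ω ∂(Q ϱ) := by
    intro ϱ hϱ
    induction ϱ using ENat.recTopCoe with
    | coe ϱ => exact hG0.trans_le (hlow ϱ (by exact_mod_cast hϱ))
    | top =>
      exact hG0.trans_le (ge_of_tendsto hspeed ((eventually_ge_atTop ϱ₀).mono hlow))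
  -- below the threshold `ϱ₀` the value of the family is irrelevant
  set R : ℕ∞ → ProbabilityMeasure Env := fun ϱ =>
    if h : (ϱ₀ : ℕ∞) ≤ ϱ then ⟨Q ϱ, hQprob ϱ h⟩ else ⟨P, inferInstance⟩ with hR
  have hRQ : ∀ ϱ : ℕ∞, (ϱ₀ : ℕ∞) ≤ ϱ → (R ϱ : Measure Env) = Q ϱ := by
    intro ϱ hϱ
    simp [hR, hϱ]
  refine ⟨R, fun ϱ => ∫ ω, drift ϱ ω ∂(Q ϱ), fun ϱ hϱ => ?_, ⟨c, C, by exact_mod_cast hc0,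
    fun ϱ hϱ => ?_⟩, ?_, hspeed⟩
  · rw [hRQ ϱ hϱ]
    have := hQprob ϱ hϱ
    refine ⟨⟨hvpos ϱ hϱ, hlln ϱ hϱ⟩, hQP ϱ hϱ, hQinv ϱ hϱ, huniq ϱ hϱ, herg ϱ hϱ, ?_, ?_, rfl⟩
    · exact (htailQ ϱ hϱ).mono fun ω hω => integrable_walkLaw_one htfin (hω.truncate ϱ 0)
    · exact Integrable.of_bound (stronglyMeasurable_drift ϱ).aestronglyMeasurable _
        ((htailQ ϱ hϱ).mono fun ω hω => abs_drift_le htfin hω)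
  · rw [hRQ ϱ hϱ]
    have := hQprob ϱ hϱ
    simpa using const_le_rnDeriv_le (hQlow ϱ hϱ) (hQup ϱ hϱ)
  · rw [ProbabilityMeasure.tendsto_iff_forall_integral_tendsto]
    intro f
    rw [hRQ ⊤ htop]
    have hf : Integrable f P := f.integrable P
    refine (tendsto_integral_of_tendsto_measure hevC (hQup ⊤ htop) hset hf).congr' ?_
    filter_upwards [hev] with ϱ h
    rw [hRQ ϱ h]
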